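/- Let $\mathcal X,\mathcal Y,\mathcal Z$ be finite alphabets and let $P_{YZ|X}$ be a discrete memoryless wiretap channel with marginal channels $P_{Y|X}$ (to the legitimate receiver) and $P_{Z|X}$ (to the eavesdropper). Call $P_{Z|X}$ \emph{full-rank} if the matrix $(P_{Z|X}(z|x))_{z\in\mathcal Z,\,x\in\mathcal X}$ has rank $|\mathcal X|$. Let $P_Z$ be a target distribution induced through $P_{Z|X}$ by at least one input distribution. For $R_0,R_1\ge 0$, let $M_0,M_1$ be independent and uniform on the integers in $[1,e^{nR_0}]$ and $[1,e^{nR_1}]$. An $(n,R_0,R_1)$ secrecy code consists of a stochastic encoder $P_{X^n|M_0M_1}$ and a stochastic decoder $P_{\widehat M_0\widehat M_1|Y^n}$; the codeword is sent over $n$ independent uses of $P_{YZ|X}$. The pair $(R_0,R_1)$ is \emph{$P_Z$-achievable} if there are $(n,R_0,R_1)$ secrecy codes, one for each $n$, such that $\mathbb P\{(M_0,M_1)\ne(\widehat M_0,\widehat M_1)\}\to 0$ as $n\to\infty$ and $P_{M_1Z^n}=P_{M_1}P_Z^{n}$ exactly for every $n$, where $P_Z^n$ is the $n$-fold product distribution.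 Let $\mathcal R(P_Z)\subseteq\mathbb R^2$ be the closure of the set of $P_Z$-achievable pairs, and let the perfect stealth capacity and the perfect stealth-secrecy capacity be $$C_0(P_Z)=\max_{(R_0,R_1)\in\mathcal R(P_Z)}R_0,\qquad C_1(P_Z)=\max_{(R_0,R_1)\in\mathcal R(P_Z)}R_1 .$$ The Gács–Körner common information of $(X,Y)$ is $C_{\mathsf{GK}}(X;Y)=\sup\{H(f(X)) : f(X)=g(Y)\text{ almost surely}\}$, where $f,g$ range over functions on $\mathcal X$ and $\mathcal Y$ and $H$ is the Shannon entropy in nats. \textbf{Theorem.} If $P_{Z|X}$ is full-rank, then exactly one input distribution $P_X$ induces $P_Z$ through $P_{Z|X}$, and with $(X,Y)\sim P_XP_{Y|X}$, $$\mathcal R(P_Z)=\{(R_0,R_1): 0\le R_0\le C_{\mathsf{GK}}(X;Y),\ R_1=0\}.$$ Both maxima above are attained, and $C_0(P_Z)=C_{\mathsf{GK}}(X;Y)$ and $C_1(P_Z)=0$. Moreover, $P_{Z|X}$ is full-rank whenever it is an identity channel ($Z=X$), or an additive channel $Z=X+N$ in a torsion-free abelian group (for instance $\mathbb Z$ or $\mathbb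 R^d$), with finite alphabets and with finitely supported noise $N$ independent of $X$. -/

import Mathlib

open Filter Topology

namespace Wiretap

/-- A channel (conditional distribution) from a finite alphabet `A` to a finite alphabet `B`:
`W a b` is the probability `W(b | a)`. -/
def IsChannel {A B : Type*} [Fintype B] (W : A → B → ℝ) : Prop :=
  ∀ a, W a ∈ stdSimplex ℝ B

/-- The marginal channel `P_{Y|X}` of a wiretap channel `P_{YZ|X}`. -/
def margY {X Y Z : Type*} [Fintype Z] (V : X → Y × Z → ℝ) : X → Y → ℝ :=
  fun x y => ∑ z, V x (y, z)

/-- The marginal channel `P_{Z|X}` of a wiretap channel `P_{YZ|X}`. -/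
def margZ {X Y Z : Type*} [Fintype Y] (V : X → Y × Z → ℝ) : X → Z → ℝ :=
  fun x z => ∑ y, V x (y, z)

/-- `rank P_{Z|X} = |X|`, where `P_{Z|X}` is the matrix with columns indexed by the inputs. -/
def IsFullRank {X Z : Type*} [Fintype X] (W : X → Z → ℝ) : Prop :=
  (Matrix.of fun (z : Z) (x : X) => W x z).rank = Fintype.card X

/-- The identity channel: the output equals the input (up to naming the letters by `e`). -/
def IsIdentityChannel {X Z : Type*} (W : X → Z → ℝ) : Prop :=
  ∃ e : X ≃ Z, ∀ x, W x (e x) = 1 ∧ ∀ z, z ≠ e x → W x z = 0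

/-- The additive channel `Z = X + N` in the group `G`: the alphabets are (through `a` and `b`)
finite subsets of `G`, and the noise `N` is independent of `X` with finitely supported
distribution `q`. -/
def IsAdditiveChannel (G : Type*) [AddCommGroup G] {X Z : Type*} (W : X → Z → ℝ) : Prop :=
  ∃ (a : X → G) (b : Z → G) (q : G →₀ ℝ),
    Function.Injective a ∧ Function.Injective b ∧
    (∀ g, 0 ≤ q g) ∧ (q.sum fun _ r => r) = 1 ∧
    ∀ x z, W x z = q (b z - a x)

/-- The set `P(P_{Z|X}, P_Z)` of the input distributions that induce `PZ` through `W`. -/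
def inputs {X Z : Type*} [Fintype X] (W : X → Z → ℝ) (PZ : Z → ℝ) : Set (X → ℝ) :=
  {PX | PX ∈ stdSimplex ℝ X ∧ ∀ z, ∑ x, W x z * PX x = PZ z}

/-- Shannon entropy (in nats). -/
noncomputable def entropy {A : Type*} [Fintype A] (P : A → ℝ) : ℝ :=
  ∑ a, Real.negMulLog (P a)

/-- The distribution of `f(X)` for `X` distributed as `P`. -/
noncomputable def pushforward {A : Type*} [Fintype A] {k : ℕ} (P : A → ℝ) (f : A → Fin k) :
    Fin k → ℝ :=
  fun w => ∑ a, if f a = w then P a else 0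

/-- The Gács–Körner common information of `(X, Y)` with joint distribution `P_X P_{Y|X}`: the
supremum of `H(f(X))` over all `f`, `g` with `f(X) = g(Y)` almost surely. -/
noncomputable def gkCommonInformation {X Y : Type*} [Fintype X] (PX : X → ℝ) (W : X → Y → ℝ) :
    ℝ :=
  sSup {h | ∃ (k : ℕ) (f : X → Fin k) (g : Y → Fin k),
    (∀ x y, PX x * W x y ≠ 0 → f x = g y) ∧ h = entropy (pushforward PX f)}

/-- Number of messages at rate `R` and block length `n`: the integers in `[1, e^{nR}]`. -/
noncomputable def numMsg (n : ℕ) (R : ℝ) : ℕ := ⌊Real.exp (n * R)⌋₊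

/-- The set of pairs of messages `(m₀, m₁)`. -/
abbrev Msg (n : ℕ) (R₀ R₁ : ℝ) : Type := Fin (numMsg n R₀) × Fin (numMsg n R₁)

/-- An `(n, R₀, R₁)` secrecy code: a stochastic encoder and a stochastic decoder. -/
structure SecrecyCode (X Y : Type*) [Fintype X] (n : ℕ) (R₀ R₁ : ℝ) where
  enc : Msg n R₀ R₁ → (Fin n → X) → ℝ
  enc_channel : IsChannel enc
  dec : (Fin n → Y) → Msg n R₀ R₁ → ℝ
  dec_channel : IsChannel dec

/-- The joint law of `((M₀, M₁), Xⁿ, Yⁿ, Zⁿ, (M̂₀, M̂₁))`: the messages are uniform, and the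
code is used on the memoryless wiretap channel `V`. -/
noncomputable def SecrecyCode.law {X Y Z : Type*} [Fintype X] {n : ℕ} {R₀ R₁ : ℝ}
    (c : SecrecyCode X Y n R₀ R₁) (V : X → Y × Z → ℝ)
    (m : Msg n R₀ R₁) (x : Fin n → X) (y : Fin n → Y) (z : Fin n → Z) (m' : Msg n R₀ R₁) : ℝ :=
  ((numMsg n R₀ : ℝ)⁻¹ * (numMsg n R₁ : ℝ)⁻¹) * c.enc m x * (∏ i, V (x i) (y i, z i)) * c.dec y m'

/-- The probability of `(M₀, M₁) ≠ (M̂₀, M̂₁)`. -/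
noncomputable def SecrecyCode.errorProb {X Y Z : Type*} [Fintype X] [Fintype Y] [Fintype Z]
    {n : ℕ} {R₀ R₁ : ℝ} (c : SecrecyCode X Y n R₀ R₁) (V : X → Y × Z → ℝ) : ℝ :=
  ∑ m, ∑ x, ∑ y, ∑ z, ∑ m', if m ≠ m' then c.law V m x y z m' else 0

/-- The joint distribution of `M₁` and `Zⁿ`. -/
noncomputable def SecrecyCode.lawM₁Z {X Y Z : Type*} [Fintype X] [Fintype Y]
    {n : ℕ} {R₀ R₁ : ℝ} (c : SecrecyCode X Y n R₀ R₁) (V : X → Y × Z → ℝ)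
    (m₁ : Fin (numMsg n R₁)) (z : Fin n → Z) : ℝ :=
  ∑ m₀, ∑ x, ∑ y, ∑ m', c.law V (m₀, m₁) x y z m'

/-- The pair of rates `(R₀, R₁)` is `PZ`-achievable: the error probability tends to zero, and
`P_{M₁ Zⁿ} = P_{M₁} P_Zⁿ` holds exactly at every block length, `M₁` being uniform. -/
def Achievable {X Y Z : Type*} [Fintype X] [Fintype Y] [Fintype Z]
    (V : X → Y × Z → ℝ) (PZ : Z → ℝ) (R₀ R₁ : ℝ) : Prop :=
  0 ≤ R₀ ∧ 0 ≤ R₁ ∧ ∃ c : (n : ℕ) → SecrecyCode X Y n R₀ R₁,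
    Tendsto (fun n => (c n).errorProb V) atTop (𝓝 0) ∧
    ∀ n m₁ z, (c n).lawM₁Z V m₁ z = (numMsg n R₁ : ℝ)⁻¹ * ∏ i, PZ (z i)

/-- The `PZ`-admissible region. -/
def region {X Y Z : Type*} [Fintype X] [Fintype Y] [Fintype Z]
    (V : X → Y × Z → ℝ) (PZ : Z → ℝ) : Set (ℝ × ℝ) :=
  closure {p | Achievable V PZ p.1 p.2}

/-- The perfect stealth capacity `C₀(P_Z)`. -/
noncomputable def stealthCapacity {X Y Z : Type*} [Fintype X] [Fintype Y] [Fintype Z]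
    (V : X → Y × Z → ℝ) (PZ : Z → ℝ) : ℝ :=
  sSup (Prod.fst '' region V PZ)

/-- The perfect stealth-secrecy capacity `C₁(P_Z)`. -/
noncomputable def stealthSecrecyCapacity {X Y Z : Type*} [Fintype X] [Fintype Y] [Fintype Z]
    (V : X → Y × Z → ℝ) (PZ : Z → ℝ) : ℝ :=
  sSup (Prod.snd '' region V PZ)

end Wiretap

/-! Full rank passes to tensor powers, so the law of `Zⁿ` determines that of the channel input.
Exact secrecy and stealth therefore force the codeword, given each value of `M₁`, to have law
`P_Xⁿ`. Then `M₁` is independent of `Yⁿ` and decoding it is blind guessing, so `R₁ = 0`. What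
remains is an agreement problem: the message is tied to an i.i.d. source `Xⁿ` and must be recovered
from the correlated `Yⁿ`.

Converse for `R₀`. Let `f(X) = g(Y)` be the maximal common part, the connected component of the
support graph of `(X, Y)`. Let `S` be the composition of conditional expectation onto `Y` with its
adjoint. Only functions of `f(X)` are fixed by `S`, so in finite dimension `S ≤ (1 - c) I + c T`,
where `T` projects onto those functions. This inequality tensorizes with the same `c`
(`SpectralGap.kronecker`). Tested on the message indicators (`agreement_bound`), it shows that
agreement with small error forces the law of `f(X)ⁿ` to put almost all its mass on letters of
probability not much above `e^{-nR₀}`, or below it; equipartition then gives `R₀ ≤ H(f(X))`.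

Achievability. For `f(X) = g(Y)` and `R₀ < H(f(X))`, the uniform message is coupled to `f(X)ⁿ` so
that it is nearly a function of it (`exists_coupling`). The encoder draws `f(X)ⁿ` given the message,
then `Xⁿ` given `f(X)ⁿ`, so `Xⁿ` is exactly i.i.d.; the receiver reads `f(X)ⁿ` off `Yⁿ`. -/

namespace Wiretap

/-! ### Full-rank channels and examples -/

section FullRank

variable {X Z : Type*} [Fintype X] [Fintype Z]

theorem isFullRank_iff_linearIndependent {W : X → Z → ℝ} :
    IsFullRank W ↔ LinearIndependent ℝ W := by
  have h : (Matrix.of fun (z : Z) (x : X) => W x z) = (Matrix.of W).transpose := rfl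
  rw [IsFullRank, h, Matrix.rank_transpose, Matrix.rank_eq_finrank_span_row,
    linearIndependent_iff_card_eq_finrank_span, eq_comm]
  rfl

theorem IsFullRank.exists_leftInverse [DecidableEq X] {W : X → Z → ℝ} (hW : IsFullRank W) :
    ∃ L : Z → X → ℝ, ∀ x x', ∑ z, W x z * L z x' = if x = x' then 1 else 0 := by
  classical
  have hli := isFullRank_iff_linearIndependent.1 hW
  have hinj : LinearMap.ker (Fintype.linearCombination ℝ W) = ⊥ :=
    LinearMap.ker_eq_bot.2 (linearIndependent_iff_injective_fintypeLinearCombination.1 hli)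
  obtain ⟨g, hg⟩ := LinearMap.exists_leftInverse_of_injective _ hinj
  refine ⟨fun z x' => g (Pi.single z 1) x', fun x x' => ?_⟩
  have h1 : g (W x) = Pi.single x 1 := by
    have := LinearMap.congr_fun hg (Pi.single x 1)
    simpa [Fintype.linearCombination_apply_single] using this
  have h2 : W x = ∑ z, W x z • (Pi.single z (1 : ℝ) : Z → ℝ) := by
    ext z
    simp [Finset.sum_apply, Pi.single_apply]
  have h3 : g (W x) x' = ∑ z, W x z * g (Pi.single z 1) x' := by
    conv_lhs => rw [h2]
    simp [map_sum, Finset.sum_apply]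
  rw [← h3, h1, Pi.single_apply]
  simp [eq_comm]

/-- The tensor power of a left inverse of `W` is a left inverse of the tensor power of `W`. -/
theorem IsFullRank.tensor_injective {W : X → Z → ℝ} (hW : IsFullRank W) {n : ℕ}
    {P Q : (Fin n → X) → ℝ}
    (h : ∀ z : Fin n → Z, ∑ x, P x * ∏ i, W (x i) (z i) = ∑ x, Q x * ∏ i, W (x i) (z i)) :
    P = Q := by
  classical
  obtain ⟨L, hL⟩ := hW.exists_leftInverse
  have key : ∀ (P : (Fin n → X) → ℝ) (x' : Fin n → X),
      ∑ z : Fin n → Z, (∑ x, P x * ∏ i, W (x i) (z i)) * ∏ i, L (z i) (x' i) = P x' := by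
    intro P x'
    calc ∑ z : Fin n → Z, (∑ x, P x * ∏ i, W (x i) (z i)) * ∏ i, L (z i) (x' i)
        = ∑ x, P x * ∑ z : Fin n → Z, ∏ i, (W (x i) (z i) * L (z i) (x' i)) := by
          simp_rw [Finset.sum_mul, Finset.mul_sum, Finset.prod_mul_distrib]
          rw [Finset.sum_comm]
          simp_rw [mul_assoc]
      _ = ∑ x, P x * ∏ i, (if x i = x' i then 1 else 0) := by
          refine Finset.sum_congr rfl fun x _ => ?_
          rw [← Fintype.prod_sum (fun i z => W (x i) z * L z (x' i))]
          simp_rw [hL]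
      _ = ∑ x, P x * (if x = x' then 1 else 0) := by
          simp_rw [Finset.prod_ite_zero, funext_iff]
          simp
      _ = P x' := by simp
  funext x'
  rw [← key P x', ← key Q x']
  simp_rw [h]

theorem IsFullRank.inputs_eq_singleton {W : X → Z → ℝ} (hW : IsFullRank W) {PZ : Z → ℝ}
    {PX : X → ℝ} (hPX : PX ∈ inputs W PZ) : inputs W PZ = {PX} := by
  classical
  obtain ⟨L, hL⟩ := hW.exists_leftInverse
  have key : ∀ P ∈ inputs W PZ, ∀ x', P x' = ∑ z, PZ z * L z x' := by
    intro P hP x'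
    simp_rw [← hP.2, Finset.sum_mul]
    rw [Finset.sum_comm]
    calc P x' = ∑ x, P x * (if x = x' then 1 else 0) := by simp
      _ = ∑ x, P x * ∑ z, W x z * L z x' := by simp_rw [hL]
      _ = _ := by
        simp_rw [Finset.mul_sum]
        exact Finset.sum_congr rfl fun x _ => Finset.sum_congr rfl fun z _ => by ring
  refine Set.eq_singleton_iff_unique_mem.2 ⟨hPX, fun P hP => ?_⟩
  funext x'
  rw [key P hP, key PX hPX]

theorem IsIdentityChannel.isFullRank {W : X → Z → ℝ} (hW : IsIdentityChannel W) :
    IsFullRank W := by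
  obtain ⟨e, he⟩ := hW
  rw [isFullRank_iff_linearIndependent, Fintype.linearIndependent_iff]
  intro c hc x
  have h := congrFun hc (e x)
  rw [Finset.sum_apply, Finset.sum_eq_single x] at h
  · simpa [(he x).1] using h
  · intro x' _ hx'
    simp [(he x').2 (e x) (fun h => hx' (e.injective h).symm)]
  · simp

/-- Only the subgroup generated by `A ∪ B` matters. It is finitely generated and torsion-free, hence
free of finite rank, and unique sums exist there. -/
theorem exists_uniqueAdd {G : Type*} [AddCommGroup G] [IsAddTorsionFree G] {A B : Finset G}
    (hA : A.Nonempty) (hB : B.Nonempty) : ∃ a ∈ A, ∃ b ∈ B, UniqueAdd A B a b := by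
  classical
  let H : AddSubgroup G := AddSubgroup.closure (A ∪ B : Finset G)
  have : AddGroup.FG H := AddGroup.closure_finset_fg _
  have : AddMonoid.FG H := AddGroup.fg_iff_addMonoid_fg.1 inferInstance
  have : IsAddTorsionFree H :=
    Function.Injective.isAddTorsionFree H.subtype H.subtype_injective
  have hmem : ∀ g ∈ A ∪ B, g ∈ H := fun g hg => AddSubgroup.subset_closure hg
  let A' : Finset H := A.subtype (· ∈ H)
  let B' : Finset H := B.subtype (· ∈ H)
  have hA' : A'.Nonempty := by
    obtain ⟨a, ha⟩ := hA
    exact ⟨⟨a, hmem a (by simp [ha])⟩, by simpa [A'] using ha⟩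
  have hB' : B'.Nonempty := by
    obtain ⟨b, hb⟩ := hB
    exact ⟨⟨b, hmem b (by simp [hb])⟩, by simpa [B'] using hb⟩
  obtain ⟨a, ha, b, hb, hu⟩ := UniqueSums.uniqueAdd_of_nonempty hA' hB'
  refine ⟨a, by simpa [A'] using ha, b, by simpa [B'] using hb, fun a' b' ha' hb' h => ?_⟩
  have := @hu ⟨a', hmem a' (by simp [ha'])⟩ ⟨b', hmem b' (by simp [hb'])⟩
    (by simpa [A'] using ha') (by simpa [B'] using hb') (Subtype.ext h)
  exact ⟨congrArg Subtype.val this.1, congrArg Subtype.val this.2⟩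

/-- In a vanishing combination of rows, take a unique sum of the support of the coefficients and
that of the noise. At this output a single term survives, and it is nonzero. -/
theorem IsAdditiveChannel.isFullRank {G : Type*} [AddCommGroup G] [IsAddTorsionFree G]
    {W : X → Z → ℝ} (hW : IsAdditiveChannel G W) (hch : IsChannel W) : IsFullRank W := by
  classical
  obtain ⟨a, b, q, ha, hb, hq0, hq1, hWq⟩ := hW
  rw [isFullRank_iff_linearIndependent, Fintype.linearIndependent_iff]
  intro c hc
  by_contra! hne
  obtain ⟨x₀, hx₀⟩ := hne
  -- Each row already sums to 1 over `Z`, so no noise mass leaves the output alphabet.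
  have hrange : ∀ x, ∀ g ∈ q.support, ∃ z, b z = g + a x := by
    intro x g hg
    by_contra! hno
    have hs : ∑ z, q (b z - a x) = 1 := by
      simp_rw [← hWq]
      exact (hch x).2
    have hinj : Function.Injective fun z => b z - a x := fun z z' h => hb (sub_left_injective h)
    have h1 : ∑ z, q (b z - a x) = ∑ h ∈ Finset.univ.image (fun z => b z - a x), q h := by
      rw [Finset.sum_image fun _ _ _ _ h => hinj h]
    have hg' : g ∉ Finset.univ.image (fun z => b z - a x) := by
      simp only [Finset.mem_image, Finset.mem_univ, true_and, not_exists]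
      exact fun z hz => hno z (by rw [← hz]; abel)
    have h2 : ∑ h ∈ insert g (Finset.univ.image (fun z => b z - a x)), q h ≤ 1 := by
      rw [← hq1, Finsupp.sum]
      calc _ ≤ ∑ h ∈ insert g (Finset.univ.image (fun z => b z - a x)) ∪ q.support, q h :=
            Finset.sum_le_sum_of_subset_of_nonneg Finset.subset_union_left fun i _ _ => hq0 i
        _ = _ := (Finset.sum_subset Finset.subset_union_right fun i _ hi => by
            simpa using hi).symm
    rw [Finset.sum_insert hg', ← h1, hs] at h2
    have : 0 < q g := lt_of_le_of_ne (hq0 g) (Ne.symm (by simpa using hg))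
    linarith
  have hqne : q.support.Nonempty := by
    rw [Finsupp.support_nonempty_iff]
    rintro rfl
    simp at hq1
  have hAne : ((Finset.univ.filter fun x => c x ≠ 0).image a).Nonempty :=
    ⟨a x₀, Finset.mem_image_of_mem a (by simpa using hx₀)⟩
  obtain ⟨g, hg, s, hs, hu⟩ := exists_uniqueAdd hAne hqne
  obtain ⟨x, hx, rfl⟩ := Finset.mem_image.1 hg
  obtain ⟨z, hz⟩ := hrange x s hs
  have h := congrFun hc z
  rw [Finset.sum_apply, Finset.sum_eq_single x] at h
  · simp only [Pi.smul_apply, hWq, hz, add_sub_cancel_right, smul_eq_mul, Pi.zero_apply,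
      mul_eq_zero] at h
    rcases h with h | h
    · exact (Finset.mem_filter.1 hx).2 h
    · exact (Finsupp.mem_support_iff.1 hs) h
  · intro x' _ hx'
    by_contra hcon
    simp only [Pi.smul_apply, hWq, smul_eq_mul, mul_eq_zero, not_or] at hcon
    have := @hu (a x') (b z - a x') (Finset.mem_image_of_mem a (by simpa using hcon.1))
      (by simpa using hcon.2) (by rw [hz]; abel)
    exact hx' (ha this.1)
  · simp

end FullRank

open scoped Kronecker Matrix

/-! ### Tensorization of the spectral gap -/

section TensorPower

variable {A B C : Type*}

/-- The `n`-fold Kronecker power of a matrix. -/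
def tensorPow (n : ℕ) (M : Matrix A B ℝ) : Matrix (Fin n → A) (Fin n → B) ℝ :=
  Matrix.of fun x y => ∏ i, M (x i) (y i)

theorem tensorPow_mul [Fintype B] (n : ℕ) (M : Matrix A B ℝ) (N : Matrix B C ℝ) :
    tensorPow n (M * N) = tensorPow n M * tensorPow n N := by
  classical
  ext x z
  simp only [tensorPow, Matrix.of_apply, Matrix.mul_apply, ← Finset.prod_mul_distrib]
  exact Fintype.prod_sum (fun i y => M (x i) y * N y (z i))

theorem tensorPow_transpose (n : ℕ) (M : Matrix A B ℝ) :
    tensorPow n Mᵀ = (tensorPow n M)ᵀ := rfl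

theorem tensorPow_succ (n : ℕ) (M : Matrix A B ℝ) :
    tensorPow (n + 1) M =
      (M ⊗ₖ tensorPow n M).submatrix (fun x => (x 0, Fin.tail x)) fun y => (y 0, Fin.tail y) := by
  ext x y
  simp [tensorPow, Fin.prod_univ_succ, Fin.tail, Matrix.kroneckerMap_apply]

/-- The matrix `S` is at most `(1 - c) I + c T` in the Loewner order, where `0 ≤ S` and
`0 ≤ T ≤ I`. -/
structure SpectralGap [Fintype A] [DecidableEq A] (c : ℝ) (S T : Matrix A A ℝ) : Prop where
  posS : S.PosSemidef
  posT : T.PosSemidef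
  leOne : (1 - T).PosSemidef
  gap : ((1 - c) • (1 : Matrix A A ℝ) + c • T - S).PosSemidef

theorem SpectralGap.kronecker [Fintype A] [DecidableEq A] [Fintype B] [DecidableEq B] {c : ℝ}
    (hc0 : 0 ≤ c) (hc1 : c ≤ 1) {S T : Matrix A A ℝ} {S' T' : Matrix B B ℝ}
    (h : SpectralGap c S T) (h' : SpectralGap c S' T') :
    SpectralGap c (S ⊗ₖ S') (T ⊗ₖ T') where
  posS := h.posS.kronecker h'.posS
  posT := h.posT.kronecker h'.posT
  leOne := by
    have e : 1 - T ⊗ₖ T' = (1 - T) ⊗ₖ (1 : Matrix B B ℝ) + T ⊗ₖ (1 - T') := by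
      rw [← Matrix.one_kronecker_one]
      ext ⟨i, i'⟩ ⟨j, j'⟩
      simp only [Matrix.sub_apply, Matrix.add_apply, Matrix.kroneckerMap_apply]
      ring
    rw [e]
    exact (h.leOne.kronecker Matrix.PosSemidef.one).add (h.posT.kronecker h'.leOne)
  gap := by
    have hM : ((1 - c) • (1 : Matrix B B ℝ) + c • T').PosSemidef :=
      (Matrix.PosSemidef.one.smul (sub_nonneg.2 hc1)).add (h'.posT.smul hc0)
    -- With `M = (1 - c) I + c T` and `M'` likewise, the first two terms telescope to `M ⊗ M' - S ⊗
    -- S'`. The last is what `M ⊗ M'` lacks from the target, so `c` does not degrade.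
    have e : (1 - c) • (1 : Matrix (A × B) (A × B) ℝ) + c • (T ⊗ₖ T') - S ⊗ₖ S' =
        ((1 - c) • (1 : Matrix A A ℝ) + c • T - S) ⊗ₖ ((1 - c) • (1 : Matrix B B ℝ) + c • T') +
        S ⊗ₖ ((1 - c) • (1 : Matrix B B ℝ) + c • T' - S') +
        (c * (1 - c)) • ((1 - T) ⊗ₖ (1 - T')) := by
      rw [← Matrix.one_kronecker_one]
      ext ⟨i, i'⟩ ⟨j, j'⟩
      simp only [Matrix.sub_apply, Matrix.add_apply, Matrix.smul_apply,
        Matrix.kroneckerMap_apply, smul_eq_mul]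
      ring
    rw [e]
    exact ((h.gap.kronecker hM).add (h.posS.kronecker h'.gap)).add
      ((h.leOne.kronecker h'.leOne).smul (mul_nonneg hc0 (sub_nonneg.2 hc1)))

theorem SpectralGap.submatrix [Fintype A] [DecidableEq A] [Fintype B] [DecidableEq B] {c : ℝ}
    {S T : Matrix A A ℝ} (h : SpectralGap c S T) {e : B → A} (he : Function.Injective e) :
    SpectralGap c (S.submatrix e e) (T.submatrix e e) where
  posS := h.posS.submatrix e
  posT := h.posT.submatrix e
  leOne := by
    have := h.leOne.submatrix e
    rwa [Matrix.submatrix_sub, Pi.sub_apply, Pi.sub_apply, Matrix.submatrix_one e he] at this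
  gap := by
    have := h.gap.submatrix e
    rwa [Matrix.submatrix_sub, Pi.sub_apply, Pi.sub_apply, Matrix.submatrix_add, Pi.add_apply,
      Pi.add_apply, Matrix.submatrix_smul, Pi.smul_apply, Pi.smul_apply, Matrix.submatrix_smul,
      Pi.smul_apply, Pi.smul_apply, Matrix.submatrix_one e he] at this

theorem SpectralGap.tensorPow [Fintype A] [DecidableEq A] {c : ℝ}
    (hc0 : 0 ≤ c) (hc1 : c ≤ 1) {S T : Matrix A A ℝ} (h : SpectralGap c S T) (n : ℕ) :
    SpectralGap c (tensorPow n S) (tensorPow n T) := by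
  induction n with
  | zero =>
    have e : ∀ M : Matrix A A ℝ, Wiretap.tensorPow 0 M = 1 := by
      intro M
      ext x y
      rw [Subsingleton.elim x y]
      simp [Wiretap.tensorPow]
    rw [e, e]
    refine ⟨Matrix.PosSemidef.one, Matrix.PosSemidef.one, ?_, ?_⟩
    · rw [sub_self]; exact Matrix.PosSemidef.zero
    · rw [← add_smul, sub_add_cancel, one_smul, sub_self]; exact Matrix.PosSemidef.zero
  | succ n ih =>
    rw [tensorPow_succ, tensorPow_succ]
    refine (h.kronecker hc0 hc1 ih).submatrix fun x y hxy => ?_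
    rw [Prod.mk.injEq] at hxy
    rw [← Fin.cons_self_tail x, ← Fin.cons_self_tail y, hxy.1, hxy.2]

end TensorPower

/-! ### Conditional expectation and the one-letter gap -/

section OneLetter

variable {X Y K : Type*} [Fintype X] [Fintype Y] [Fintype K]

/-- The output distribution of the channel `W` for the input distribution `P`. -/
def outDist (P : X → ℝ) (W : X → Y → ℝ) : Y → ℝ := fun y => ∑ x, P x * W x y

/-- The matrix of the conditional expectation operator of the joint distribution `P W`, in the
orthonormal bases given by the normalized indicator functions. -/
noncomputable def corr (P : X → ℝ) (W : X → Y → ℝ) : Matrix X Y ℝ :=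
  Matrix.of fun x y => √(P x) * W x y / √(outDist P W y)

/-- The defect operator: its squared norm measures how far `a` is from being determined by the
output of the channel. -/
noncomputable def defect (P : X → ℝ) (W : X → Y → ℝ) : (X → ℝ) →ₗ[ℝ] (X × Y → ℝ) where
  toFun a p := a p.1 * √(W p.1 p.2) -
    √(P p.1 * W p.1 p.2 / outDist P W p.2) * ∑ x, a x * corr P W x p.2
  map_add' a b := by
    ext p
    simp only [Pi.add_apply, add_mul, Finset.sum_add_distrib]
    ring
  map_smul' r a := by
    ext p
    simp only [Pi.smul_apply, smul_eq_mul, mul_assoc, ← Finset.mul_sum, RingHom.id_apply]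
    ring

theorem outDist_nonneg {P : X → ℝ} {W : X → Y → ℝ} (hP : P ∈ stdSimplex ℝ X)
    (hW : IsChannel W) (y : Y) : 0 ≤ outDist P W y :=
  Finset.sum_nonneg fun x _ => mul_nonneg (hP.1 x) ((hW x).1 y)

theorem le_outDist {P : X → ℝ} {W : X → Y → ℝ} (hP : P ∈ stdSimplex ℝ X)
    (hW : IsChannel W) (x : X) (y : Y) : P x * W x y ≤ outDist P W y :=
  Finset.single_le_sum (f := fun x => P x * W x y)
    (fun x _ => mul_nonneg (hP.1 x) ((hW x).1 y)) (Finset.mem_univ x)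

theorem outDist_mem_stdSimplex {P : X → ℝ} {W : X → Y → ℝ} (hP : P ∈ stdSimplex ℝ X)
    (hW : IsChannel W) : outDist P W ∈ stdSimplex ℝ Y := by
  refine ⟨outDist_nonneg hP hW, ?_⟩
  simp only [outDist]
  rw [Finset.sum_comm]
  simp_rw [← Finset.mul_sum, (hW _).2, mul_one]
  exact hP.2

/-- For `a = √P · φ` this is the law of total variance: the left side is the mean square of `φ(X) -
E[φ(X) | Y]`. The weight `√W` on `a` also counts inputs of probability zero. -/
theorem sum_defect_sq {P : X → ℝ} {W : X → Y → ℝ} (hP : P ∈ stdSimplex ℝ X)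
    (hW : IsChannel W) (a : X → ℝ) :
    ∑ p, defect P W a p ^ 2 = ∑ x, a x ^ 2 - ∑ y, (∑ x, a x * corr P W x y) ^ 2 := by
  have hout := outDist_nonneg hP hW
  set b : Y → ℝ := fun y => ∑ x, a x * corr P W x y with hb
  have hexp : ∀ x y, defect P W a (x, y) ^ 2 = a x ^ 2 * W x y - 2 * (a x * corr P W x y) * b y +
      (P x * W x y / outDist P W y) * b y ^ 2 := by
    intro x y
    have h1 : √(W x y) ^ 2 = W x y := Real.sq_sqrt ((hW x).1 y)
    have h2 : √(P x * W x y / outDist P W y) ^ 2 = P x * W x y / outDist P W y :=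
      Real.sq_sqrt (div_nonneg (mul_nonneg (hP.1 x) ((hW x).1 y)) (hout y))
    have h3 : √(W x y) * √(P x * W x y / outDist P W y) = corr P W x y := by
      rw [Real.sqrt_div (mul_nonneg (hP.1 x) ((hW x).1 y)), Real.sqrt_mul (hP.1 x)]
      simp only [corr, Matrix.of_apply]
      rw [mul_div_assoc', mul_left_comm, Real.mul_self_sqrt ((hW x).1 y)]
    change (a x * √(W x y) - √(P x * W x y / outDist P W y) * b y) ^ 2 = _
    calc _ = a x ^ 2 * √(W x y) ^ 2
          - 2 * (a x * (√(W x y) * √(P x * W x y / outDist P W y))) * b y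
          + √(P x * W x y / outDist P W y) ^ 2 * b y ^ 2 := by ring
      _ = _ := by rw [h1, h2, h3]
  have hb2 : ∀ y, (∑ x, P x * W x y / outDist P W y) * b y ^ 2 = b y ^ 2 := by
    intro y
    by_cases hy : outDist P W y = 0
    · have : b y = 0 := by simp [hb, corr, hy]
      simp [this]
    · rw [← Finset.sum_div]
      change outDist P W y / outDist P W y * _ = _
      rw [div_self hy, one_mul]
  have hx : ∑ x, ∑ y, a x ^ 2 * W x y = ∑ x, a x ^ 2 := by
    simp_rw [← Finset.mul_sum, (hW _).2, mul_one]
  have hy1 : ∑ x, ∑ y, 2 * (a x * corr P W x y) * b y = 2 * ∑ y, b y ^ 2 := by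
    rw [Finset.sum_comm, Finset.mul_sum]
    refine Finset.sum_congr rfl fun y _ => ?_
    rw [← Finset.sum_mul, ← Finset.mul_sum]
    change 2 * b y * b y = _
    ring
  have hy2 : ∑ x, ∑ y, (P x * W x y / outDist P W y) * b y ^ 2 = ∑ y, b y ^ 2 := by
    rw [Finset.sum_comm]
    simp_rw [← Finset.sum_mul, hb2]
  rw [Fintype.sum_prod_type]
  simp_rw [hexp, Finset.sum_add_distrib, Finset.sum_sub_distrib]
  rw [hx, hy1, hy2]
  ring

theorem dotProduct_mul_transpose_mulVec (M : Matrix X Y ℝ) (a : X → ℝ) :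
    a ⬝ᵥ ((M * Mᵀ) *ᵥ a) = ∑ y, (∑ x, a x * M x y) ^ 2 := by
  rw [← Matrix.mulVec_mulVec, Matrix.dotProduct_mulVec, Matrix.mulVec_transpose]
  simp [dotProduct, Matrix.vecMul, sq]

theorem posSemidef_mul_transpose (M : Matrix X Y ℝ) : (M * Mᵀ).PosSemidef := by
  simpa using Matrix.posSemidef_self_mul_conjTranspose M

/-- The kernel inclusion makes `D` factor through `C`, and a linear map in finite dimension is
bounded. -/
theorem exists_sum_sq_le {E F G : Type*} [Fintype E] [Fintype F] [Fintype G]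
    (C : (E → ℝ) →ₗ[ℝ] (F → ℝ)) (D : (E → ℝ) →ₗ[ℝ] (G → ℝ))
    (h : ∀ a, C a = 0 → D a = 0) :
    ∃ K : ℝ, 0 ≤ K ∧ ∀ a, ∑ i, D a i ^ 2 ≤ K * ∑ j, C a j ^ 2 := by
  have hker : LinearMap.ker C ≤ LinearMap.ker D := h
  obtain ⟨R, hR⟩ := LinearMap.exists_extend
    (((LinearMap.ker C).liftQ D hker) ∘ₗ (LinearMap.quotKerEquivRange C).symm.toLinearMap)
  have hRD : ∀ a, R (C a) = D a := by
    intro a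
    have := LinearMap.congr_fun hR ⟨C a, LinearMap.mem_range_self C a⟩
    have e : (LinearMap.quotKerEquivRange C).symm ⟨C a, LinearMap.mem_range_self C a⟩ =
        (LinearMap.ker C).mkQ a := LinearMap.quotKerEquivRange_symm_apply_image C a _
    simpa [e] using this
  let R' := LinearMap.toContinuousLinearMap R
  refine ⟨Fintype.card G * ‖R'‖ ^ 2, by positivity, fun a => ?_⟩
  have h1 : ‖C a‖ ^ 2 ≤ ∑ j, C a j ^ 2 := by
    have hs : 0 ≤ ∑ j, C a j ^ 2 := Finset.sum_nonneg fun _ _ => sq_nonneg _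
    refine (Real.le_sqrt (norm_nonneg _) hs).1 ((pi_norm_le_iff_of_nonneg (Real.sqrt_nonneg _)).2
      fun j => Real.le_sqrt_of_sq_le ?_)
    rw [Real.norm_eq_abs, sq_abs]
    exact Finset.single_le_sum (f := fun j => C a j ^ 2) (fun _ _ => sq_nonneg _)
      (Finset.mem_univ j)
  have h2 : ‖D a‖ ≤ ‖R'‖ * ‖C a‖ := by
    rw [← hRD]
    exact R'.le_opNorm (C a)
  calc ∑ i, D a i ^ 2 ≤ ∑ _i : G, ‖D a‖ ^ 2 := by
        refine Finset.sum_le_sum fun i _ => ?_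
        rw [← sq_abs]
        exact pow_le_pow_left₀ (abs_nonneg _) (norm_le_pi_norm (D a) i) 2
    _ = Fintype.card G * ‖D a‖ ^ 2 := by simp
    _ ≤ Fintype.card G * (‖R'‖ * ‖C a‖) ^ 2 := by gcongr
    _ = Fintype.card G * ‖R'‖ ^ 2 * ‖C a‖ ^ 2 := by ring
    _ ≤ _ := by gcongr

theorem exists_spectralGap [DecidableEq X] {P : X → ℝ} {W : X → Y → ℝ} {V : X → K → ℝ}
    (hP : P ∈ stdSimplex ℝ X) (hW : IsChannel W) (hV : IsChannel V)
    (hker : ∀ a, defect P W a = 0 → defect P V a = 0) :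
    ∃ c : ℝ, 0 < c ∧ c ≤ 1 ∧
      SpectralGap c (corr P W * (corr P W)ᵀ) (corr P V * (corr P V)ᵀ) := by
  obtain ⟨k, hk0, hk⟩ := exists_sum_sq_le (defect P W) (defect P V) hker
  -- The gap says that `c` times the squared defect of `V` is at most that of `W`. Using `k + 1`
  -- keeps `c` in `(0, 1]` even if `k = 0`.
  refine ⟨(k + 1)⁻¹, by positivity, inv_le_one_of_one_le₀ (by linarith), posSemidef_mul_transpose _,
    posSemidef_mul_transpose _, ?_, ?_⟩
  · refine .of_dotProduct_mulVec_nonneg (Matrix.isHermitian_one.sub (posSemidef_mul_transpose _).1) fun a => ?_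
    rw [star_trivial, Matrix.sub_mulVec, dotProduct_sub, dotProduct_mul_transpose_mulVec,
      Matrix.one_mulVec]
    have := sum_defect_sq hP hV a
    have h0 : 0 ≤ ∑ p, defect P V a p ^ 2 := Finset.sum_nonneg fun _ _ => sq_nonneg _
    simp only [dotProduct, ← sq]
    linarith
  · refine .of_dotProduct_mulVec_nonneg (((Matrix.isHermitian_one.smul (IsSelfAdjoint.all _)).add
      ((posSemidef_mul_transpose _).1.smul (IsSelfAdjoint.all _))).sub
        (posSemidef_mul_transpose _).1) fun a => ?_
    rw [star_trivial, Matrix.sub_mulVec, Matrix.add_mulVec, dotProduct_sub, dotProduct_add,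
      Matrix.smul_mulVec, Matrix.smul_mulVec, dotProduct_smul, dotProduct_smul,
      dotProduct_mul_transpose_mulVec, dotProduct_mul_transpose_mulVec, Matrix.one_mulVec]
    have h1 := sum_defect_sq hP hV a
    have h2 := sum_defect_sq hP hW a
    have h3 := hk a
    have h0 : 0 ≤ ∑ p, defect P W a p ^ 2 := Finset.sum_nonneg fun _ _ => sq_nonneg _
    have h4 : (k + 1)⁻¹ * ∑ p, defect P V a p ^ 2 ≤ ∑ p, defect P W a p ^ 2 := by
      rw [inv_mul_le_iff₀ (by positivity)]
      linarith
    rw [h1] at h4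
    simp only [dotProduct, ← sq, smul_eq_mul]
    linarith

end OneLetter

/-! ### The Gács–Körner common part -/

section CommonPart

variable {X Y : Type*} [Fintype X]

/-- The deterministic channel given by a function. -/
noncomputable def detChannel {A : Type*} {k : ℕ} (f : A → Fin k) : A → Fin k → ℝ :=
  fun a w => if f a = w then 1 else 0

theorem isChannel_detChannel {A : Type*} {k : ℕ} (f : A → Fin k) : IsChannel (detChannel f) := by
  refine fun a => ⟨fun w => ?_, ?_⟩
  · simp only [detChannel]
    split_ifs <;> norm_num
  · simp [detChannel]

theorem outDist_detChannel {k : ℕ} (P : X → ℝ) (f : X → Fin k) :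
    outDist P (detChannel f) = pushforward P f := by
  ext w
  simp [outDist, detChannel, pushforward]

theorem pushforward_mem_stdSimplex {k : ℕ} {P : X → ℝ} (hP : P ∈ stdSimplex ℝ X)
    (f : X → Fin k) : pushforward P f ∈ stdSimplex ℝ (Fin k) := by
  rw [← outDist_detChannel]
  exact outDist_mem_stdSimplex hP (isChannel_detChannel f)

theorem le_pushforward {k : ℕ} {P : X → ℝ} (hP : P ∈ stdSimplex ℝ X)
    (f : X → Fin k) (x : X) : P x ≤ pushforward P f (f x) := by
  rw [← outDist_detChannel]
  simpa [detChannel] using le_outDist hP (isChannel_detChannel f) x (f x)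

theorem defect_detChannel_eq_zero {k : ℕ} {P : X → ℝ} (hP : P ∈ stdSimplex ℝ X)
    (f : X → Fin k) (t : Fin k → ℝ) : defect P (detChannel f) (fun x => √(P x) * t (f x)) = 0 := by
  have hb : ∀ w, ∑ x, √(P x) * t (f x) * corr P (detChannel f) x w =
      t w * √(pushforward P f w) := by
    intro w
    have : ∀ x, √(P x) * t (f x) * corr P (detChannel f) x w =
        (t w / √(pushforward P f w)) * (if f x = w then P x else 0) := by
      intro x
      simp only [corr, Matrix.of_apply, outDist_detChannel, detChannel]
      split_ifs with h
      · rw [h]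
        nth_rewrite 3 [← Real.mul_self_sqrt (hP.1 x)]
        ring
      · simp
    simp_rw [this, ← Finset.mul_sum]
    change t w / √(pushforward P f w) * pushforward P f w = _
    rw [div_mul_eq_mul_div, mul_div_assoc, Real.div_sqrt]
  ext ⟨x, w⟩
  change √(P x) * t (f x) * √(detChannel f x w) -
    √(P x * detChannel f x w / outDist P (detChannel f) w) *
      ∑ x, √(P x) * t (f x) * corr P (detChannel f) x w = 0
  rw [hb, outDist_detChannel]
  by_cases h : f x = w
  · subst h
    have hle := le_pushforward hP f x
    simp only [detChannel, if_true, Real.sqrt_one, mul_one]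
    rw [Real.sqrt_div (hP.1 x)]
    rcases eq_or_lt_of_le (hP.1 x) with h0 | h0
    · simp [← h0]
    · have : √(pushforward P f (f x)) ≠ 0 := (Real.sqrt_pos.2 (h0.trans_le hle)).ne'
      field_simp
      ring
  · simp [detChannel, h]

/-- Label the connected components of the bipartite support graph. Zero defect makes the normalized
function constant along edges, hence a function of the component. -/
theorem exists_common_part [Fintype Y] {P : X → ℝ} {W : X → Y → ℝ} (hP : P ∈ stdSimplex ℝ X)
    (hW : IsChannel W) :
    ∃ (k : ℕ) (f : X → Fin k) (g : Y → Fin k), (∀ x y, P x * W x y ≠ 0 → f x = g y) ∧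
      ∀ a, defect P W a = 0 → defect P (detChannel f) a = 0 := by
  classical
  let r : X ⊕ Y → X ⊕ Y → Prop := fun u v =>
    ∃ x y, u = Sum.inl x ∧ v = Sum.inr y ∧ P x * W x y ≠ 0
  obtain ⟨k, ⟨e⟩⟩ := Finite.exists_equiv_fin (Quot r)
  refine ⟨k, fun x => e (Quot.mk r (Sum.inl x)), fun y => e (Quot.mk r (Sum.inr y)),
    fun x y hxy => congrArg e (Quot.sound ⟨x, y, rfl, rfl, hxy⟩), fun a ha => ?_⟩
  set b : Y → ℝ := fun y => ∑ x, a x * corr P W x y with hb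
  have hab : ∀ x y, a x * √(W x y) = √(P x * W x y / outDist P W y) * b y := fun x y =>
    sub_eq_zero.1 (congrFun ha (x, y))
  let h : X ⊕ Y → ℝ := Sum.elim (fun x => a x / √(P x)) fun y => b y / √(outDist P W y)
  have hr : ∀ u v, r u v → h u = h v := by
    rintro _ _ ⟨x, y, rfl, rfl, hxy⟩
    have hPx : 0 < P x := lt_of_le_of_ne (hP.1 x) fun h => hxy (by simp [← h])
    have hWx : 0 < W x y := lt_of_le_of_ne ((hW x).1 y) fun h => hxy (by simp [← h])
    have ho : 0 < outDist P W y := (mul_pos hPx hWx).trans_le (le_outDist hP hW x y)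
    have := hab x y
    rw [Real.sqrt_div (mul_nonneg hPx.le hWx.le), Real.sqrt_mul hPx.le] at this
    have h1 := Real.sqrt_pos.2 hPx
    have h2 := Real.sqrt_pos.2 hWx
    have h3 := Real.sqrt_pos.2 ho
    simp only [h, Sum.elim_inl, Sum.elim_inr]
    rw [div_eq_div_iff h1.ne' h3.ne']
    refine mul_right_cancel₀ h2.ne' ?_
    calc a x * √(outDist P W y) * √(W x y) = (a x * √(W x y)) * √(outDist P W y) := by ring
      _ = _ := by
        rw [this]
        field_simp
  let t : Fin k → ℝ := fun w => Quot.lift h hr (e.symm w)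
  have hat : a = fun x => √(P x) * t (e (Quot.mk r (Sum.inl x))) := by
    funext x
    have ht : t (e (Quot.mk r (Sum.inl x))) = a x / √(P x) := by
      simp only [t, Equiv.symm_apply_apply, h, Sum.elim_inl]
    rw [ht]
    -- If `P x = 0` the quotient is 0 by convention, so `a x = 0` is needed; it follows from the
    -- zero defect at any output reachable from `x`.
    rcases eq_or_lt_of_le (hP.1 x) with h0 | h0
    · obtain ⟨y, hy⟩ : ∃ y, W x y ≠ 0 := by
        by_contra! hno
        have := (hW x).2
        simp [hno] at this
      have := hab x y
      rw [← h0] at this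
      have hy' : √(W x y) ≠ 0 :=
        (Real.sqrt_pos.2 (lt_of_le_of_ne ((hW x).1 y) (Ne.symm hy))).ne'
      have : a x = 0 := by simpa [hy'] using this
      simp [this]
    · rw [mul_div_cancel₀ _ (Real.sqrt_pos.2 h0).ne']
  rw [hat]
  exact defect_detChannel_eq_zero hP _ t

theorem negMulLog_le_one {x : ℝ} (hx : 0 ≤ x) : Real.negMulLog x ≤ 1 := by
  rcases eq_or_lt_of_le hx with rfl | h0
  · simp
  · have h1 := Real.log_le_sub_one_of_pos (inv_pos.2 h0)
    rw [Real.log_inv] at h1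
    have h2 := mul_le_mul_of_nonneg_left h1 h0.le
    rw [mul_sub, mul_inv_cancel₀ h0.ne'] at h2
    simp only [Real.negMulLog]
    linarith

/-- The number `k` of labels is unrestricted, but at most `|X|` of them occur. This bounds the set
whose supremum is the common information. -/
theorem entropy_pushforward_le_card {k : ℕ} {P : X → ℝ} (hP : P ∈ stdSimplex ℝ X)
    (f : X → Fin k) : entropy (pushforward P f) ≤ Fintype.card X := by
  classical
  have h0 : ∀ w ∈ Finset.univ, w ∉ Finset.univ.image f →
      Real.negMulLog (pushforward P f w) = 0 := by
    intro w _ hw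
    have : pushforward P f w = 0 := Finset.sum_eq_zero fun x _ =>
      if_neg fun h => hw (Finset.mem_image.2 ⟨x, Finset.mem_univ x, h⟩)
    simp [this]
  rw [entropy, ← Finset.sum_subset (Finset.subset_univ (Finset.univ.image f)) h0]
  calc _ ≤ ∑ _w ∈ Finset.univ.image f, (1 : ℝ) := Finset.sum_le_sum fun w _ =>
        negMulLog_le_one ((pushforward_mem_stdSimplex hP f).1 w)
    _ = ((Finset.univ.image f).card : ℝ) := by simp
    _ ≤ _ := by exact_mod_cast Finset.card_image_le

theorem entropy_le_gkCommonInformation {k : ℕ} {P : X → ℝ} {W : X → Y → ℝ}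
    (hP : P ∈ stdSimplex ℝ X) {f : X → Fin k} {g : Y → Fin k}
    (hfg : ∀ x y, P x * W x y ≠ 0 → f x = g y) :
    entropy (pushforward P f) ≤ gkCommonInformation P W := by
  refine le_csSup ⟨Fintype.card X, ?_⟩ ⟨k, f, g, hfg, rfl⟩
  rintro _ ⟨k, f, g, _, rfl⟩
  exact entropy_pushforward_le_card hP f

theorem exists_entropy_gt {P : X → ℝ} {W : X → Y → ℝ} {R : ℝ}
    (hR : R < gkCommonInformation P W) :
    ∃ (k : ℕ) (f : X → Fin k) (g : Y → Fin k), (∀ x y, P x * W x y ≠ 0 → f x = g y) ∧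
      R < entropy (pushforward P f) := by
  have hne : {h | ∃ (k : ℕ) (f : X → Fin k) (g : Y → Fin k),
      (∀ x y, P x * W x y ≠ 0 → f x = g y) ∧ h = entropy (pushforward P f)}.Nonempty :=
    ⟨_, 1, fun _ => 0, fun _ => 0, fun _ _ _ => rfl, rfl⟩
  obtain ⟨_, ⟨k, f, g, hfg, rfl⟩, h⟩ := exists_lt_of_lt_csSup hne hR
  exact ⟨k, f, g, hfg, h⟩

theorem gkCommonInformation_nonneg {P : X → ℝ} (hP : P ∈ stdSimplex ℝ X) (W : X → Y → ℝ) :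
    0 ≤ gkCommonInformation P W := by
  refine le_trans ?_ (entropy_le_gkCommonInformation (k := 1) hP (W := W)
    (f := fun _ => 0) (g := fun _ => 0) fun _ _ _ => rfl)
  simp [entropy, pushforward, hP.2]

end CommonPart

/-! ### Equipartition by exponential moments -/

section TypicalSet

variable {A : Type*} [Fintype A]

theorem sum_prod_mul_exp (p : A → ℝ) (s t : ℝ) (n : ℕ) :
    ∑ k : Fin n → A, (∏ i, p (k i)) * Real.exp (s * (Real.log (∏ i, p (k i)) - n * t)) =
      (∑ a, p a * Real.exp (s * (Real.log (p a) - t))) ^ n := by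
  classical
  have h : (∑ a, p a * Real.exp (s * (Real.log (p a) - t))) ^ n =
      ∏ _i : Fin n, ∑ a, p a * Real.exp (s * (Real.log (p a) - t)) := by simp
  rw [h, Fintype.prod_sum]
  refine Finset.sum_congr rfl fun k _ => ?_
  rw [Finset.prod_mul_distrib]
  -- The logarithm of the product splits only if no factor is zero; otherwise the weight vanishes.
  by_cases h0 : ∃ i, p (k i) = 0
  · obtain ⟨i, hi⟩ := h0
    rw [Finset.prod_eq_zero (f := fun i => p (k i)) (Finset.mem_univ i) hi, zero_mul, zero_mul]
  · push Not at h0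
    rw [Real.log_prod fun i _ => h0 i, ← Real.exp_sum, ← Finset.mul_sum, Finset.sum_sub_distrib]
    simp

theorem sum_prod_eq_one {p : A → ℝ} (hp : ∑ a, p a = 1) (n : ℕ) :
    ∑ k : Fin n → A, ∏ i, p (k i) = 1 := by
  classical
  rw [← Fintype.prod_sum (fun (_ : Fin n) a => p a)]
  simp [hp]

theorem hasDerivAt_sum_mul_exp {p : A → ℝ} (hp : p ∈ stdSimplex ℝ A) (t : ℝ) :
    HasDerivAt (fun s => ∑ a, p a * Real.exp (s * (Real.log (p a) - t))) (-entropy p - t) 0 := by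
  have h : HasDerivAt (fun s => ∑ a, p a * Real.exp (s * (Real.log (p a) - t)))
      (∑ a, p a * (Real.exp (0 * (Real.log (p a) - t)) * (1 * (Real.log (p a) - t)))) 0 :=
    HasDerivAt.fun_sum fun a _ =>
      (((hasDerivAt_id (0 : ℝ)).mul_const (Real.log (p a) - t)).exp).const_mul (p a)
  convert h using 1
  simp only [zero_mul, Real.exp_zero, one_mul]
  simp only [mul_sub, Finset.sum_sub_distrib,
    ← Finset.sum_mul, hp.2, entropy, Real.negMulLog, neg_mul, Finset.sum_neg_distrib, neg_neg, one_mul]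

/-- Chernoff bound: on the event the exponential is at least 1, so its probability is at most the
`n`-th power of a moment below 1. -/
theorem tendsto_sum_prod_ite {p : A → ℝ} (hp : p ∈ stdSimplex ℝ A) {s t : ℝ}
    (hs : ∑ a, p a * Real.exp (s * (Real.log (p a) - t)) < 1) {B : (n : ℕ) → ℝ → Prop}
    [∀ n x, Decidable (B n x)]
    (hB : ∀ n x, 0 < x → B n x → 0 ≤ s * (Real.log x - n * t)) :
    Tendsto (fun n : ℕ => ∑ k : Fin n → A, if B n (∏ i, p (k i)) then ∏ i, p (k i) else 0)
      atTop (𝓝 0) := by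
  have h0 : 0 ≤ ∑ a, p a * Real.exp (s * (Real.log (p a) - t)) :=
    Finset.sum_nonneg fun a _ => mul_nonneg (hp.1 a) (Real.exp_nonneg _)
  have hpk : ∀ {n : ℕ} (k : Fin n → A), 0 ≤ ∏ i, p (k i) := fun k =>
    Finset.prod_nonneg fun i _ => hp.1 _
  refine squeeze_zero (fun n => Finset.sum_nonneg fun k _ => ?_) (fun n => ?_)
    (tendsto_pow_atTop_nhds_zero_of_lt_one h0 hs)
  · split_ifs
    exacts [hpk k, le_rfl]
  · rw [← sum_prod_mul_exp]
    refine Finset.sum_le_sum fun k _ => ?_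
    split_ifs with h
    · rcases eq_or_lt_of_le (hpk k) with h1 | h1
      · simp [← h1]
      · exact le_mul_of_one_le_right h1.le (Real.one_le_exp (hB n _ h1 h))
    · exact mul_nonneg (hpk k) (Real.exp_nonneg _)

/-- The moment is 1 at `s = 0` with slope `-entropy p - t < 0`, so it is below 1 at some `s > 0`.
The opposite tail uses some `s < 0`. -/
theorem tendsto_sum_exp_lt_prod {p : A → ℝ} (hp : p ∈ stdSimplex ℝ A) {t : ℝ}
    (ht : -entropy p < t) :
    Tendsto (fun n : ℕ => ∑ k : Fin n → A,
      if Real.exp (n * t) < ∏ i, p (k i) then ∏ i, p (k i) else 0) atTop (𝓝 0) := by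
  have hd := (hasDerivAt_sum_mul_exp hp t).tendsto_slope
  have hev := (hd.mono_left (nhdsGT_le_nhdsNE 0)).eventually_lt_const
    (show -entropy p - t < 0 by linarith)
  obtain ⟨s, hs, hs0⟩ := (hev.and self_mem_nhdsWithin).exists
  have hs0 : 0 < s := hs0
  refine tendsto_sum_prod_ite hp (s := s) (t := t) ?_ (B := fun n x => Real.exp (n * t) < x)
    fun n x hx hB => mul_nonneg hs0.le (sub_nonneg.2 ((Real.le_log_iff_exp_le hx).2 hB.le))
  rw [slope_def_field, sub_zero, div_neg_iff] at hs
  have : ∑ a, p a * Real.exp (0 * (Real.log (p a) - t)) = 1 := by simp [hp.2]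
  rcases hs with hs | hs <;> linarith [hs.1, hs.2]

theorem tendsto_sum_prod_lt_exp {p : A → ℝ} (hp : p ∈ stdSimplex ℝ A) {t : ℝ}
    (ht : t < -entropy p) :
    Tendsto (fun n : ℕ => ∑ k : Fin n → A,
      if ∏ i, p (k i) < Real.exp (n * t) then ∏ i, p (k i) else 0) atTop (𝓝 0) := by
  have hd := (hasDerivAt_sum_mul_exp hp t).tendsto_slope
  have hev := (hd.mono_left (nhdsLT_le_nhdsNE 0)).eventually_const_lt
    (show 0 < -entropy p - t by linarith)
  obtain ⟨s, hs, hs0⟩ := (hev.and self_mem_nhdsWithin).exists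
  have hs0 : s < 0 := hs0
  refine tendsto_sum_prod_ite hp (s := s) (t := t) ?_ (B := fun n x => x < Real.exp (n * t))
    fun n x hx hB => mul_nonneg_of_nonpos_of_nonpos hs0.le
      (sub_nonpos.2 ((Real.log_le_iff_le_exp hx).2 hB.le))
  rw [slope_def_field, sub_zero, div_pos_iff] at hs
  have : ∑ a, p a * Real.exp (0 * (Real.log (p a) - t)) = 1 := by simp [hp.2]
  rcases hs with hs | hs <;> linarith [hs.1, hs.2]

end TypicalSet

/-! ### Coupling a source with a uniform message -/

section Coupling

/-- The half-open intervals `[F i, F (i + 1))` are disjoint; as differences of indicators, the terms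
telescope. -/
theorem sum_range_ite_le_lt {F : ℕ → ℝ} (hF : Monotone F) (c : ℝ) (N : ℕ) :
    ∑ i ∈ Finset.range N, (if F i ≤ c ∧ c < F (i + 1) then (1 : ℝ) else 0) ≤ 1 := by
  have h : ∀ i, (if F i ≤ c ∧ c < F (i + 1) then (1 : ℝ) else 0) =
      (if c < F (i + 1) then 1 else 0) - (if c < F i then 1 else 0) := by
    intro i
    have := hF (Nat.le_succ i)
    by_cases h1 : c < F i
    · have h2 : c < F (i + 1) := h1.trans_le this
      simp [h1, h2, not_le.2 h1]
    · simp [h1, not_lt.1 h1]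
  simp_rw [h]
  rw [Finset.sum_range_sub (fun i => if c < F i then (1 : ℝ) else 0)]
  split_ifs <;> norm_num

/-- The length of the overlap of the intervals `[a, b]` and `[c, d]`. -/
noncomputable def overlap (a b c d : ℝ) : ℝ := (min b d - min b c) - (min a d - min a c)

theorem overlap_nonneg {a b c d : ℝ} (hab : a ≤ b) (hcd : c ≤ d) : 0 ≤ overlap a b c d := by
  simp only [overlap, min_def]
  split_ifs <;> linarith

/-- The cumulative-distribution coupling of a distribution with the uniform distribution on
`L` points: the point is a function of the letter up to an error governed by the letters of
probability more than `τ`. -/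
theorem exists_coupling {A : Type*} [Fintype A] {q : A → ℝ} (hq : q ∈ stdSimplex ℝ A) {L : ℕ}
    (hL : 0 < L) {τ : ℝ} (hτ : 0 ≤ τ) :
    ∃ (Q : Fin L → A → ℝ) (φ : A → Fin L), (∀ m a, 0 ≤ Q m a) ∧ (∀ a, ∑ m, Q m a = q a) ∧
      (∀ m, ∑ a, Q m a = (L : ℝ)⁻¹) ∧
      ∑ a, (q a - Q (φ a) a) ≤ L * τ + ∑ a, if τ < q a then q a else 0 := by
  classical
  set N := Fintype.card A with hN
  let e : A ≃ Fin N := Fintype.equivFin A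
  let q' : ℕ → ℝ := fun j => if h : j < N then q (e.symm ⟨j, h⟩) else 0
  have hq'e : ∀ a, q' (e a) = q a := fun a => by simp [q']
  have hq'0 : ∀ j, 0 ≤ q' j := fun j => by
    simp only [q']
    split_ifs
    exacts [hq.1 _, le_rfl]
  have hsum : ∀ h : ℕ → ℝ, ∑ a, h (e a) = ∑ j ∈ Finset.range N, h j := fun h => by
    rw [Equiv.sum_comp e (fun j : Fin N => h j), Fin.sum_univ_eq_sum_range]
  let F : ℕ → ℝ := fun i => ∑ j ∈ Finset.range i, q' j
  have hF0 : F 0 = 0 := by simp [F]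
  have hFs : ∀ i, F (i + 1) = F i + q' i := fun i => Finset.sum_range_succ _ _
  have hFmono : Monotone F := monotone_nat_of_le_succ fun i => by
    rw [hFs]
    linarith [hq'0 i]
  have hFN : F N = 1 := by
    rw [← hq.2, ← Finset.sum_congr rfl fun a _ => hq'e a]
    exact (hsum q').symm
  have hFnn : ∀ i, 0 ≤ F i := fun i => hF0 ▸ hFmono (Nat.zero_le i)
  have hFle : ∀ i ≤ N, F i ≤ 1 := fun i hi => hFN ▸ hFmono hi
  have hLr : (0 : ℝ) < L := by exact_mod_cast hL
  -- Letters tile `[0, 1]` by intervals of length `q`, messages by cells of length `1 / L`. As a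
  -- double difference of `min`, the overlap telescopes in either index and gives both marginals.
  let Q : ℕ → ℕ → ℝ := fun m i => overlap (F i) (F (i + 1)) (m / L) ((m + 1 : ℕ) / L)
  have hcell : ∀ m : ℕ, (m : ℝ) / L ≤ ((m + 1 : ℕ) : ℝ) / L := fun m => by
    gcongr
    linarith
  have hQ0 : ∀ m i, 0 ≤ Q m i := fun m i => overlap_nonneg (hFmono (Nat.le_succ i)) (hcell m)
  have hQq : ∀ i < N, ∑ m ∈ Finset.range L, Q m i = q' i := by
    intro i hi
    simp only [Q, overlap]
    rw [Finset.sum_sub_distrib,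
      Finset.sum_range_sub (fun m : ℕ => min (F (i + 1)) ((m : ℝ) / L)),
      Finset.sum_range_sub (fun m : ℕ => min (F i) ((m : ℝ) / L)), div_self hLr.ne',
      min_eq_left (hFle _ hi), min_eq_left (hFle _ hi.le)]
    simp only [Nat.cast_zero, zero_div, min_eq_right (hFnn _)]
    rw [hFs]
    ring
  have hQL : ∀ m < L, ∑ i ∈ Finset.range N, Q m i = (L : ℝ)⁻¹ := by
    intro m hm
    have h1 : ((m + 1 : ℕ) : ℝ) / L ≤ 1 := by
      rw [div_le_one hLr]
      exact_mod_cast hm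
    have h2 : (m : ℝ) / L ≤ 1 := (hcell m).trans h1
    have h3 : 0 ≤ (m : ℝ) / L := by positivity
    simp only [Q, overlap]
    rw [Finset.sum_range_sub (fun i => min (F i) (((m + 1 : ℕ) : ℝ) / L) - min (F i) ((m : ℝ) / L)),
      hFN, hF0, min_eq_right h1, min_eq_right h2, min_eq_left h3, min_eq_left (h3.trans (hcell m))]
    push_cast
    field_simp
    ring
  -- `φ i` is a cell containing the left endpoint of the interval of letter `i`.
  have hφ : ∀ i < N, ∃ m < L, (m : ℝ) / L ≤ F i ∧ F i ≤ ((m + 1 : ℕ) : ℝ) / L := by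
    intro i hi
    by_cases h : ⌊F i * L⌋₊ < L
    · refine ⟨_, h, ?_, ?_⟩
      · rw [div_le_iff₀ hLr]
        exact Nat.floor_le (mul_nonneg (hFnn i) hLr.le)
      · rw [le_div_iff₀ hLr]
        push_cast
        exact (Nat.lt_floor_add_one _).le
    -- Letters of mass zero may sit at the endpoint 1, where the floor would be `L`; the last cell
    -- is used instead.
    · have h1 : (L : ℝ) ≤ F i * L :=
        (Nat.le_floor_iff (mul_nonneg (hFnn i) hLr.le)).1 (not_lt.1 h)
      have h2 : F i = 1 := le_antisymm (hFle i hi.le) (by nlinarith)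
      refine ⟨L - 1, by omega, ?_, ?_⟩
      · rw [div_le_iff₀ hLr, h2, one_mul]
        exact_mod_cast Nat.sub_le _ _
      · rw [Nat.sub_add_cancel hL, h2, div_self hLr.ne']
  choose! φ hφL hφ1 hφ2 using hφ
  -- A letter loses mass only if it crosses the right end of its cell. Each cell end is crossed by
  -- at most one letter, so letters of mass at most `τ` lose at most `L * τ` in total.
  have herr : ∀ i < N, q' i - Q (φ i) i ≤ (if τ < q' i then q' i else 0) +
      ∑ m ∈ Finset.range L,
        τ * (if F i ≤ ((m + 1 : ℕ) : ℝ) / L ∧ ((m + 1 : ℕ) : ℝ) / L < F (i + 1) then 1 else 0) := by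
    intro i hi
    have hnn : ∀ m : ℕ, 0 ≤ τ * (if F i ≤ ((m + 1 : ℕ) : ℝ) / L ∧
        ((m + 1 : ℕ) : ℝ) / L < F (i + 1) then (1 : ℝ) else 0) := fun m => by
      split_ifs
      · simpa using hτ
      · simp
    have hle : q' i - Q (φ i) i ≤ q' i := by linarith [hQ0 (φ i) i]
    split_ifs with h
    · linarith [Finset.sum_nonneg fun m (_ : m ∈ Finset.range L) => hnn m]
    · rw [zero_add]
      by_cases hc : ((φ i + 1 : ℕ) : ℝ) / L < F (i + 1)
      · refine le_trans ?_ (Finset.single_le_sum (fun m _ => hnn m)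
          (Finset.mem_range.2 (hφL i hi)))
        rw [if_pos ⟨hφ2 i hi, hc⟩, mul_one]
        exact hle.trans (not_lt.1 h)
      · have hQi : Q (φ i) i = q' i := by
          simp only [Q, overlap]
          rw [min_eq_left (not_lt.1 hc), min_eq_left (hφ2 i hi), min_eq_right (hφ1 i hi),
            min_eq_right ((hφ1 i hi).trans (hFmono (Nat.le_succ i))), hFs]
          ring
        rw [hQi, sub_self]
        exact Finset.sum_nonneg fun m _ => hnn m
  refine ⟨fun m a => Q m (e a), fun a => ⟨φ (e a), hφL _ (e a).2⟩, fun m a => hQ0 _ _,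
    fun a => ?_, fun m => ?_, ?_⟩
  · rw [Fin.sum_univ_eq_sum_range (fun m => Q m (e a)), hQq _ (e a).2, hq'e]
  · rw [hsum (fun j => Q m j), hQL m m.2]
  · have h1 : ∑ a, (q a - Q (φ (e a)) (e a)) = ∑ i ∈ Finset.range N, (q' i - Q (φ i) i) := by
      rw [← hsum (fun i => q' i - Q (φ i) i)]
      simp_rw [hq'e]
    have h2 : (∑ a, if τ < q a then q a else 0) =
        ∑ i ∈ Finset.range N, if τ < q' i then q' i else 0 := by
      rw [← hsum (fun i => if τ < q' i then q' i else 0)]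
      simp_rw [hq'e]
    rw [h1, h2]
    refine (Finset.sum_le_sum fun i hi => herr i (Finset.mem_range.1 hi)).trans ?_
    rw [Finset.sum_add_distrib, add_comm, Finset.sum_comm]
    gcongr
    calc _ ≤ ∑ _m ∈ Finset.range L, τ := by
          refine Finset.sum_le_sum fun m _ => ?_
          rw [← Finset.mul_sum]
          exact mul_le_of_le_one_right hτ (sum_range_ite_le_lt hFmono _ N)
      _ = L * τ := by simp

end Coupling

/-! ### Memoryless sources and channels -/

section Memoryless

variable {X Y : Type*}

/-- The distribution of `n` independent letters. -/
def iidDist (n : ℕ) (P : X → ℝ) : (Fin n → X) → ℝ := fun x => ∏ i, P (x i)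

/-- The channel given by `n` independent uses. -/
def iidChannel (n : ℕ) (W : X → Y → ℝ) : (Fin n → X) → (Fin n → Y) → ℝ :=
  fun x y => ∏ i, W (x i) (y i)

theorem iidDist_mem_stdSimplex [Fintype X] {P : X → ℝ} (hP : P ∈ stdSimplex ℝ X) (n : ℕ) :
    iidDist n P ∈ stdSimplex ℝ (Fin n → X) :=
  ⟨fun _ => Finset.prod_nonneg fun _ _ => hP.1 _, sum_prod_eq_one hP.2 n⟩

theorem isChannel_iidChannel [Fintype Y] {W : X → Y → ℝ} (hW : IsChannel W) (n : ℕ) :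
    IsChannel (iidChannel n W) := by
  classical
  refine fun x => ⟨fun _ => Finset.prod_nonneg fun _ _ => (hW _).1 _, ?_⟩
  simp only [iidChannel]
  rw [← Fintype.prod_sum (fun i y => W (x i) y)]
  simp [(hW _).2]

theorem outDist_iid [Fintype X] (P : X → ℝ) (W : X → Y → ℝ) (n : ℕ) :
    outDist (iidDist n P) (iidChannel n W) = iidDist n (outDist P W) := by
  classical
  ext y
  simp only [outDist, iidDist, iidChannel, ← Finset.prod_mul_distrib]
  exact (Fintype.prod_sum (fun i x => P x * W x (y i))).symm

theorem corr_iid [Fintype X] [Fintype Y] {P : X → ℝ} {W : X → Y → ℝ} (hP : P ∈ stdSimplex ℝ X)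
    (hW : IsChannel W) (n : ℕ) :
    corr (iidDist n P) (iidChannel n W) = tensorPow n (corr P W) := by
  ext x y
  simp only [corr, tensorPow, Matrix.of_apply, outDist_iid, Finset.prod_div_distrib,
    Finset.prod_mul_distrib]
  simp only [iidDist, iidChannel]
  rw [Real.sqrt_prod _ fun i _ => hP.1 _, Real.sqrt_prod _ fun i _ => outDist_nonneg hP hW _]

theorem iidChannel_detChannel {k : ℕ} (f : X → Fin k) (n : ℕ) (x : Fin n → X) (w : Fin n → Fin k) :
    iidChannel n (detChannel f) x w = if f ∘ x = w then 1 else 0 := by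
  simp [iidChannel, detChannel, Finset.prod_ite_zero, funext_iff]

theorem sum_comp_mul_iidDist [Fintype X] {k : ℕ} (P : X → ℝ) (f : X → Fin k) (n : ℕ)
    (h : (Fin n → Fin k) → ℝ) :
    ∑ x : Fin n → X, h (f ∘ x) * iidDist n P x = ∑ w, h w * iidDist n (pushforward P f) w := by
  rw [← outDist_detChannel, ← outDist_iid]
  simp only [outDist, Finset.mul_sum]
  rw [Finset.sum_comm]
  refine Finset.sum_congr rfl fun x _ => ?_
  simp [iidChannel_detChannel]

end Memoryless

/-! ### The agreement bound -/

section Agreement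

theorem sum_mul_corr {X Y : Type*} [Fintype X] {P : X → ℝ} (W : X → Y → ℝ) {j : X → ℝ}
    (hj : ∀ x, P x = 0 → j x = 0) (hP : ∀ x, 0 ≤ P x) (y : Y) :
    ∑ x, j x / √(P x) * corr P W x y = (∑ x, j x * W x y) / √(outDist P W y) := by
  rw [Finset.sum_div]
  refine Finset.sum_congr rfl fun x _ => ?_
  simp only [corr, Matrix.of_apply]
  rcases eq_or_lt_of_le (hP x) with h | h
  · simp [hj x h.symm]
  · have := (Real.sqrt_pos.2 h).ne'
    field_simp

variable {X Y K M : Type*} [Fintype X] [Fintype Y] [Fintype K] [Fintype M]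

theorem div_le_of_sq {a b : ℝ} (ha : 0 ≤ a) (hab : a ≤ b) : a ^ 2 / b ≤ a := by
  rcases eq_or_lt_of_le (ha.trans hab) with h | h
  · simp [← h, ha]
  · rw [div_le_iff₀ h, sq]
    exact mul_le_mul_of_nonneg_left hab ha

/-- If a random variable with law bounded by `l`, obtained from the input of a channel, agrees
with one obtained from the output except with probability `ε`, then the common part of the
input and the output is concentrated on few letters. -/
theorem agreement_bound [DecidableEq X] {P : X → ℝ} {W : X → Y → ℝ} {V : X → K → ℝ}
    (hP : P ∈ stdSimplex ℝ X) (hW : IsChannel W) (hV : IsChannel V) {c : ℝ} (hc0 : 0 < c)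
    (hc1 : c ≤ 1)
    (hgap : SpectralGap c (corr P W * (corr P W)ᵀ) (corr P V * (corr P V)ᵀ))
    {J : M → X → ℝ} {D : Y → M → ℝ} (hJ0 : ∀ m x, 0 ≤ J m x) (hJP : ∀ x, ∑ m, J m x = P x)
    {l : ℝ} (hl : ∀ m, ∑ x, J m x ≤ l) (hD : IsChannel D) {ε : ℝ}
    (hε : 1 - ε ≤ ∑ m, ∑ x, ∑ y, J m x * W x y * D y m) {τ : ℝ} (hτ : 0 < τ) :
    1 - 2 * ε / c ≤ l / τ + ∑ k, if outDist P V k < τ then outDist P V k else 0 := by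
  have hJle : ∀ m x, J m x ≤ P x := fun m x => by
    rw [← hJP x]
    exact Finset.single_le_sum (f := fun m => J m x) (fun m _ => hJ0 m x) (Finset.mem_univ m)
  have hJz : ∀ m x, P x = 0 → J m x = 0 := fun m x h => le_antisymm (h ▸ hJle m x) (hJ0 m x)
  have hout0 : ∀ y, 0 ≤ outDist P W y := outDist_nonneg hP hW
  have houtV0 : ∀ k, 0 ≤ outDist P V k := outDist_nonneg hP hV
  have hsq : ∀ (s t : ℝ), 0 ≤ t → (s / √t) ^ 2 = s ^ 2 / t := fun s t ht => by
    rw [div_pow, Real.sq_sqrt ht]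
  let N : M → Y → ℝ := fun m y => ∑ x, J m x * W x y
  let N' : M → K → ℝ := fun m k => ∑ x, J m x * V x k
  have hN'0 : ∀ m k, 0 ≤ N' m k := fun m k =>
    Finset.sum_nonneg fun x _ => mul_nonneg (hJ0 m x) ((hV x).1 k)
  have hNle : ∀ m y, N m y ≤ outDist P W y := fun m y =>
    Finset.sum_le_sum fun x _ => mul_le_mul_of_nonneg_right (hJle m x) ((hW x).1 y)
  have hN0 : ∀ m y, 0 ≤ N m y := fun m y =>
    Finset.sum_nonneg fun x _ => mul_nonneg (hJ0 m x) ((hW x).1 y)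
  have hN'le : ∀ m k, N' m k ≤ outDist P V k := fun m k =>
    Finset.sum_le_sum fun x _ => mul_le_mul_of_nonneg_right (hJle m x) ((hV x).1 k)
  have hN'l : ∀ m k, N' m k ≤ l := fun m k => by
    refine le_trans (Finset.sum_le_sum fun x _ => ?_) (hl m)
    refine mul_le_of_le_one_right (hJ0 m x) ?_
    rw [← (hV x).2]
    exact Finset.single_le_sum (f := V x) (fun k _ => (hV x).1 k) (Finset.mem_univ k)
  have hN'sum : ∀ k, ∑ m, N' m k = outDist P V k := fun k => by
    simp only [N', outDist]
    rw [Finset.sum_comm]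
    simp_rw [← Finset.sum_mul, hJP]
  -- The gap, tested on the vector `J m / √P`.
  have hquad : ∀ m, ∑ y, N m y ^ 2 / outDist P W y ≤
      (1 - c) * ∑ x, J m x ^ 2 / P x + c * ∑ k, N' m k ^ 2 / outDist P V k := by
    intro m
    have h := hgap.gap.dotProduct_mulVec_nonneg (fun x => J m x / √(P x))
    rw [star_trivial, Matrix.sub_mulVec, Matrix.add_mulVec, dotProduct_sub, dotProduct_add,
      Matrix.smul_mulVec, Matrix.smul_mulVec, dotProduct_smul, dotProduct_smul,
      dotProduct_mul_transpose_mulVec, dotProduct_mul_transpose_mulVec, Matrix.one_mulVec] at h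
    simp only [sum_mul_corr _ (hJz m) hP.1, hsq _ _ (hout0 _), hsq _ _ (houtV0 _),
      smul_eq_mul, dotProduct, ← sq, hsq _ _ (hP.1 _)] at h
    linarith
  have h1 : ∑ m, ∑ x, J m x ^ 2 / P x ≤ 1 := by
    rw [Finset.sum_comm, ← hP.2]
    refine Finset.sum_le_sum fun x _ => ?_
    rw [← hJP x]
    refine Finset.sum_le_sum fun m _ => ?_
    rw [hJP x]
    exact div_le_of_sq (hJ0 m x) (hJle m x)
  -- A letter of mass at least `τ` contributes at most `l`, since `N' ≤ l`, and `l` is at most `l /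
  -- τ` times its mass. A rarer letter contributes at most its mass.
  have h2 : ∑ m, ∑ k, N' m k ^ 2 / outDist P V k ≤
      l / τ + ∑ k, if outDist P V k < τ then outDist P V k else 0 := by
    have hk : ∀ k, ∑ m, N' m k ^ 2 / outDist P V k ≤
        l / τ * outDist P V k + if outDist P V k < τ then outDist P V k else 0 := by
      intro k
      rcases isEmpty_or_nonempty M with hM | ⟨⟨m₀⟩⟩
      · have h0 : outDist P V k = 0 := by rw [← hN'sum k]; simp
        simp [h0]
      have hl0 : 0 ≤ l := (hN'0 m₀ k).trans (hN'l m₀ k)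
      split_ifs with h
      · calc _ ≤ ∑ m, N' m k := Finset.sum_le_sum fun m _ =>
              div_le_of_sq (hN'0 m k) (hN'le m k)
          _ = outDist P V k := hN'sum k
          _ ≤ _ := le_add_of_nonneg_left (mul_nonneg (div_nonneg hl0 hτ.le) (houtV0 k))
      · have hpos : 0 < outDist P V k := hτ.trans_le (not_lt.1 h)
        calc ∑ m, N' m k ^ 2 / outDist P V k ≤ ∑ m, l * N' m k / outDist P V k := by
              refine Finset.sum_le_sum fun m _ => ?_
              rw [sq]
              gcongr
              · exact hN'0 m k
              · exact hN'l m k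
          _ = l := by
              rw [← Finset.sum_div, ← Finset.mul_sum, hN'sum, mul_div_cancel_right₀ _ hpos.ne']
          _ ≤ l / τ * outDist P V k := by
              rw [div_mul_eq_mul_div, le_div_iff₀ hτ]
              exact mul_le_mul_of_nonneg_left (not_lt.1 h) hl0
          _ = _ := (add_zero _).symm
    rw [Finset.sum_comm]
    refine (Finset.sum_le_sum fun k _ => hk k).trans ?_
    rw [Finset.sum_add_distrib, ← Finset.mul_sum, (outDist_mem_stdSimplex hP hV).2, mul_one]
  -- AM-GM gives `N D ≤ (N² / Q + Q D²) / 2` with `Q` the output law, and `D² ≤ D`.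
  have h3 : ∑ m, ∑ x, ∑ y, J m x * W x y * D y m ≤
      (1 / 2) * ∑ m, ∑ y, N m y ^ 2 / outDist P W y + 1 / 2 := by
    have hm : ∀ m y, N m y * D y m ≤
        (1 / 2) * (N m y ^ 2 / outDist P W y) + (1 / 2) * (outDist P W y * D y m) := by
      intro m y
      have hD1 : D y m ≤ 1 := by
        rw [← (hD y).2]
        exact Finset.single_le_sum (f := D y) (fun m _ => (hD y).1 m) (Finset.mem_univ m)
      rcases eq_or_lt_of_le (hout0 y) with h | h
      · have : N m y = 0 := le_antisymm (h ▸ hNle m y) (hN0 m y)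
        simp [this, ← h]
      · have e : N m y * D y m ≤
            (1 / 2) * (N m y ^ 2 / outDist P W y) + (1 / 2) * (outDist P W y * D y m ^ 2) := by
          have hs : 0 ≤ (N m y - outDist P W y * D y m) ^ 2 / outDist P W y := by positivity
          have : (N m y - outDist P W y * D y m) ^ 2 / outDist P W y =
              N m y ^ 2 / outDist P W y - 2 * (N m y * D y m) + outDist P W y * D y m ^ 2 := by
            field_simp
            ring
          linarith
        have : outDist P W y * D y m ^ 2 ≤ outDist P W y * D y m := by
          have := (hD y).1 m
          gcongr
          nlinarith
        linarith
    calc ∑ m, ∑ x, ∑ y, J m x * W x y * D y m = ∑ m, ∑ y, N m y * D y m := by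
          refine Finset.sum_congr rfl fun m _ => ?_
          rw [Finset.sum_comm]
          simp_rw [← Finset.sum_mul, N]
      _ ≤ ∑ m, ∑ y, ((1 / 2) * (N m y ^ 2 / outDist P W y) +
            (1 / 2) * (outDist P W y * D y m)) :=
          Finset.sum_le_sum fun m _ => Finset.sum_le_sum fun y _ => hm m y
      _ = (1 / 2) * ∑ m, ∑ y, N m y ^ 2 / outDist P W y +
            (1 / 2) * ∑ y, outDist P W y * ∑ m, D y m := by
          simp_rw [Finset.sum_add_distrib, ← Finset.mul_sum]
          congr 2
          rw [Finset.sum_comm]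
          simp_rw [← Finset.mul_sum]
      _ = _ := by simp_rw [(hD _).2, mul_one, (outDist_mem_stdSimplex hP hW).2]; ring
  have h4 := Finset.sum_le_sum fun m (_ : m ∈ Finset.univ) => hquad m
  rw [Finset.sum_add_distrib, ← Finset.mul_sum, ← Finset.mul_sum] at h4
  have h5 : (1 - c) * ∑ m, ∑ x, J m x ^ 2 / P x ≤ 1 - c :=
    mul_le_of_le_one_right (by linarith) h1
  refine le_trans ?_ h2
  rw [sub_le_iff_le_add, ← sub_le_iff_le_add', le_div_iff₀ hc0]
  linarith

end Agreement

/-! ### Marginal channels and message counts -/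

section Marginals

variable {X Y Z : Type*}

theorem isChannel_margY [Fintype Y] [Fintype Z] {V : X → Y × Z → ℝ} (hV : IsChannel V) : IsChannel (margY V) :=
  fun x => ⟨fun _ => Finset.sum_nonneg fun _ _ => (hV x).1 _, by
    rw [← (hV x).2, Fintype.sum_prod_type]; rfl⟩

theorem isChannel_margZ [Fintype Y] [Fintype Z] {V : X → Y × Z → ℝ} (hV : IsChannel V) : IsChannel (margZ V) :=
  fun x => ⟨fun _ => Finset.sum_nonneg fun _ _ => (hV x).1 _, by
    rw [← (hV x).2, Fintype.sum_prod_type_right]; rfl⟩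

theorem sum_prod_margY [Fintype Z] (V : X → Y × Z → ℝ) {n : ℕ} (x : Fin n → X) (y : Fin n → Y) :
    ∑ z : Fin n → Z, ∏ i, V (x i) (y i, z i) = iidChannel n (margY V) x y := by
  classical
  exact (Fintype.prod_sum (fun i z => V (x i) (y i, z))).symm

theorem sum_prod_margZ [Fintype Y] (V : X → Y × Z → ℝ) {n : ℕ} (x : Fin n → X) (z : Fin n → Z) :
    ∑ y : Fin n → Y, ∏ i, V (x i) (y i, z i) = iidChannel n (margZ V) x z := by
  classical
  exact (Fintype.prod_sum (fun i y => V (x i) (y, z i))).symm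

end Marginals

theorem numMsg_pos (n : ℕ) {R : ℝ} (hR : 0 ≤ R) : 0 < numMsg n R :=
  Nat.floor_pos.2 (Real.one_le_exp (by positivity))

theorem numMsg_le (n : ℕ) (R : ℝ) : (numMsg n R : ℝ) ≤ Real.exp (n * R) :=
  Nat.floor_le (Real.exp_nonneg _)

theorem inv_numMsg_le (n : ℕ) {R : ℝ} (hR : 0 ≤ R) :
    (numMsg n R : ℝ)⁻¹ ≤ 2 * Real.exp (-(n * R)) := by
  have h1 : (1 : ℝ) ≤ numMsg n R := by exact_mod_cast numMsg_pos n hR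
  have h2 : Real.exp (n * R) < numMsg n R + 1 := Nat.lt_floor_add_one _
  rw [Real.exp_neg, ← div_eq_mul_inv, le_div_iff₀ (Real.exp_pos _), inv_mul_le_iff₀ (by linarith)]
  linarith

theorem tendsto_exp_mul_atTop {r : ℝ} (hr : r < 0) :
    Tendsto (fun n : ℕ => Real.exp (n * r)) atTop (𝓝 0) :=
  Real.tendsto_exp_atBot.comp (tendsto_natCast_atTop_atTop.atTop_mul_const_of_neg hr)

theorem tendsto_inv_numMsg {R : ℝ} (hR : 0 < R) :
    Tendsto (fun n => (numMsg n R : ℝ)⁻¹) atTop (𝓝 0) := by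
  refine squeeze_zero (fun n => by positivity) (fun n => inv_numMsg_le n hR.le) ?_
  have := (tendsto_exp_mul_atTop (neg_lt_zero.2 hR)).const_mul 2
  simpa using this

/-! ### Converse -/

section Code

variable {X Y Z : Type*} [Fintype X] [Fintype Y] {n : ℕ} {R₀ R₁ : ℝ}

theorem SecrecyCode.lawM₁Z_eq (c : SecrecyCode X Y n R₀ R₁) (V : X → Y × Z → ℝ)
    (m₁ : Fin (numMsg n R₁)) (z : Fin n → Z) :
    c.lawM₁Z V m₁ z = (numMsg n R₁ : ℝ)⁻¹ *
      ∑ x, ((numMsg n R₀ : ℝ)⁻¹ * ∑ m₀, c.enc (m₀, m₁) x) * iidChannel n (margZ V) x z := by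
  simp only [lawM₁Z, law, ← Finset.mul_sum, (c.dec_channel _).2, mul_one, sum_prod_margZ]
  rw [Finset.sum_comm]
  simp only [Finset.mul_sum, Finset.sum_mul]
  exact Finset.sum_congr rfl fun x _ => Finset.sum_congr rfl fun m _ => by ring

variable [Fintype Z]

theorem SecrecyCode.errorProb_eq (c : SecrecyCode X Y n R₀ R₁) {V : X → Y × Z → ℝ}
    (hV : IsChannel V) (h₀ : 0 ≤ R₀) (h₁ : 0 ≤ R₁) :
    c.errorProb V = 1 - ∑ m, ∑ x, ∑ y, ((numMsg n R₀ : ℝ)⁻¹ * (numMsg n R₁ : ℝ)⁻¹) * c.enc m x *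
      iidChannel n (margY V) x y * c.dec y m := by
  have hm : ∀ m y (K : ℝ), ∑ m', (if m ≠ m' then K * c.dec y m' else 0) =
      K * (1 - c.dec y m) := by
    intro m y K
    rw [← (c.dec_channel y).2, mul_sub, Finset.mul_sum,
      ← Finset.sum_erase_eq_sub (f := fun m => K * c.dec y m) (Finset.mem_univ m),
      ← Finset.sum_filter]
    congr 1
    ext m'
    simp [eq_comm]
  have h0 : (numMsg n R₀ : ℝ) ≠ 0 := by exact_mod_cast (numMsg_pos n h₀).ne'
  have h1 : (numMsg n R₁ : ℝ) ≠ 0 := by exact_mod_cast (numMsg_pos n h₁).ne'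
  have htot : ∑ m, ∑ x, ∑ y, ((numMsg n R₀ : ℝ)⁻¹ * (numMsg n R₁ : ℝ)⁻¹) * c.enc m x *
      iidChannel n (margY V) x y = 1 := by
    simp only [← Finset.mul_sum, (isChannel_iidChannel (isChannel_margY hV) n _).2, mul_one,
      (c.enc_channel _).2]
    simp only [Finset.sum_const, Finset.card_univ, Fintype.card_prod, Fintype.card_fin,
      nsmul_eq_mul, Nat.cast_mul]
    field_simp
  rw [← htot]
  simp only [errorProb, law, hm]
  simp only [← Finset.sum_sub_distrib]
  refine Finset.sum_congr rfl fun m _ => Finset.sum_congr rfl fun x _ =>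
    Finset.sum_congr rfl fun y _ => ?_
  rw [← Finset.sum_mul, ← Finset.mul_sum, sum_prod_margY]
  ring

/-- Exact secrecy and stealth over a full-rank channel force the codeword to be independent of
the secret message and to have independent letters. -/
theorem SecrecyCode.sum_enc_eq (c : SecrecyCode X Y n R₀ R₁) {V : X → Y × Z → ℝ}
    (hrank : IsFullRank (margZ V)) (h₁ : 0 ≤ R₁) {PZ : Z → ℝ} {PX : X → ℝ}
    (hPX : PX ∈ inputs (margZ V) PZ)
    (hlaw : ∀ m₁ z, c.lawM₁Z V m₁ z = (numMsg n R₁ : ℝ)⁻¹ * ∏ i, PZ (z i))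
    (m₁ : Fin (numMsg n R₁)) (x : Fin n → X) :
    (numMsg n R₀ : ℝ)⁻¹ * ∑ m₀, c.enc (m₀, m₁) x = iidDist n PX x := by
  have h1 : (numMsg n R₁ : ℝ)⁻¹ ≠ 0 := inv_ne_zero (by exact_mod_cast (numMsg_pos n h₁).ne')
  refine congrFun (hrank.tensor_injective (P := fun x =>
    (numMsg n R₀ : ℝ)⁻¹ * ∑ m₀, c.enc (m₀, m₁) x) (Q := iidDist n PX) fun z => ?_) x
  have h := hlaw m₁ z
  rw [c.lawM₁Z_eq] at h
  refine (mul_left_cancel₀ h1 h).trans ?_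
  have hPZ : PZ = outDist PX (margZ V) := by
    ext z
    rw [← hPX.2 z]
    exact Finset.sum_congr rfl fun x _ => mul_comm _ _
  rw [hPZ]
  exact (congrFun (outDist_iid PX (margZ V) n) z).symm

/-- Even if only `M₁` had to be decoded, `Yⁿ` is independent of it, so a correct guess has
probability `1 / numMsg n R₁`. -/
theorem SecrecyCode.one_sub_inv_le_errorProb (c : SecrecyCode X Y n R₀ R₁) {V : X → Y × Z → ℝ}
    (hV : IsChannel V) (h₀ : 0 ≤ R₀) (h₁ : 0 ≤ R₁) {P : (Fin n → X) → ℝ} (hP : ∑ x, P x = 1)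
    (henc : ∀ m₁ x, (numMsg n R₀ : ℝ)⁻¹ * ∑ m₀, c.enc (m₀, m₁) x = P x) :
    1 - (numMsg n R₁ : ℝ)⁻¹ ≤ c.errorProb V := by
  rw [c.errorProb_eq hV h₀ h₁]
  refine sub_le_sub_left ?_ 1
  have hW := isChannel_iidChannel (isChannel_margY hV) n
  calc _ ≤ ∑ m : Msg n R₀ R₁, ∑ x, ∑ y, ((numMsg n R₀ : ℝ)⁻¹ * (numMsg n R₁ : ℝ)⁻¹) *
        c.enc m x * iidChannel n (margY V) x y * ∑ m₀, c.dec y (m₀, m.2) := by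
        refine Finset.sum_le_sum fun m _ => Finset.sum_le_sum fun x _ =>
          Finset.sum_le_sum fun y _ => ?_
        refine mul_le_mul_of_nonneg_left ?_ (mul_nonneg (mul_nonneg (by positivity)
          ((c.enc_channel m).1 x)) ((hW x).1 y))
        exact Finset.single_le_sum (f := fun m₀ => c.dec y (m₀, m.2))
          (fun _ _ => (c.dec_channel y).1 _) (Finset.mem_univ m.1)
    _ = ∑ m₁, ∑ x, ∑ y, (numMsg n R₁ : ℝ)⁻¹ *
          ((numMsg n R₀ : ℝ)⁻¹ * ∑ m₀, c.enc (m₀, m₁) x) * iidChannel n (margY V) x y *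
            ∑ m₀, c.dec y (m₀, m₁) := by
        rw [Fintype.sum_prod_type_right]
        refine Finset.sum_congr rfl fun m₁ _ => ?_
        rw [Finset.sum_comm]
        refine Finset.sum_congr rfl fun x _ => ?_
        rw [Finset.sum_comm]
        refine Finset.sum_congr rfl fun y _ => ?_
        simp only [← Finset.sum_mul, ← Finset.mul_sum]
        ring
    _ = (numMsg n R₁ : ℝ)⁻¹ * ∑ x, P x * ∑ y, iidChannel n (margY V) x y *
          ∑ m₁, ∑ m₀, c.dec y (m₀, m₁) := by
        simp only [henc, Finset.mul_sum]
        rw [Finset.sum_comm]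
        refine Finset.sum_congr rfl fun x _ => ?_
        rw [Finset.sum_comm]
        refine Finset.sum_congr rfl fun y _ => Finset.sum_congr rfl fun m₁ _ =>
          Finset.sum_congr rfl fun m₀ _ => ?_
        ring
    _ = (numMsg n R₁ : ℝ)⁻¹ := by
        simp only [← Fintype.sum_prod_type_right, (c.dec_channel _).2, mul_one, (hW _).2, hP]

theorem SecrecyCode.agreement_bound (c : SecrecyCode X Y n R₀ R₁) {V : X → Y × Z → ℝ}
    (hV : IsChannel V) (h₀ : 0 ≤ R₀) (h₁ : 0 ≤ R₁) {P : X → ℝ} (hP : P ∈ stdSimplex ℝ X)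
    (henc : ∀ m₁ x, (numMsg n R₀ : ℝ)⁻¹ * ∑ m₀, c.enc (m₀, m₁) x = iidDist n P x)
    [DecidableEq X] {k : ℕ} {f : X → Fin k} {γ : ℝ} (hγ0 : 0 < γ) (hγ1 : γ ≤ 1)
    (hgap : SpectralGap γ (corr P (margY V) * (corr P (margY V)).transpose)
      (corr P (detChannel f) * (corr P (detChannel f)).transpose)) {τ : ℝ} (hτ : 0 < τ) :
    1 - 2 * c.errorProb V / γ ≤ (numMsg n R₀ : ℝ)⁻¹ / τ +
      ∑ w, if iidDist n (pushforward P f) w < τ then iidDist n (pushforward P f) w else 0 := by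
  have hW := isChannel_margY hV
  have hg := hgap.tensorPow hγ0.le hγ1 n
  rw [tensorPow_mul, tensorPow_mul, tensorPow_transpose, tensorPow_transpose, ← corr_iid hP hW,
    ← corr_iid hP (isChannel_detChannel f)] at hg
  have h1 : (1 : ℝ) ≤ numMsg n R₁ := by exact_mod_cast numMsg_pos n h₁
  have hout : iidDist n (pushforward P f) = outDist (iidDist n P) (iidChannel n (detChannel f)) := by
    rw [outDist_iid, outDist_detChannel]
  rw [hout]
  refine Wiretap.agreement_bound (iidDist_mem_stdSimplex hP n) (isChannel_iidChannel hW n)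
    (isChannel_iidChannel (isChannel_detChannel f) n) hγ0 hγ1 hg
    (J := fun m x => ((numMsg n R₀ : ℝ)⁻¹ * (numMsg n R₁ : ℝ)⁻¹) * c.enc m x)
    (fun m x => mul_nonneg (by positivity) ((c.enc_channel m).1 x)) (fun x => ?_) (fun m => ?_)
    c.dec_channel ?_ hτ
  · calc _ = ∑ m₁, (numMsg n R₁ : ℝ)⁻¹ * ((numMsg n R₀ : ℝ)⁻¹ * ∑ m₀, c.enc (m₀, m₁) x) := by
          rw [Fintype.sum_prod_type_right]
          refine Finset.sum_congr rfl fun m₁ _ => ?_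
          rw [← Finset.mul_sum]
          ring
      _ = _ := by
          simp only [henc, Finset.sum_const, Finset.card_univ, Fintype.card_fin, nsmul_eq_mul]
          field_simp
  · rw [← Finset.mul_sum, (c.enc_channel m).2, mul_one]
    exact mul_le_of_le_one_right (by positivity) (inv_le_one_of_one_le₀ h1)
  · rw [c.errorProb_eq hV h₀ h₁]
    linarith

theorem Achievable.eq_zero_and_le {V : X → Y × Z → ℝ} (hV : IsChannel V)
    (hrank : IsFullRank (margZ V)) {PZ : Z → ℝ} {PX : X → ℝ} (hPX : PX ∈ inputs (margZ V) PZ)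
    (h : Achievable V PZ R₀ R₁) : R₁ = 0 ∧ R₀ ≤ gkCommonInformation PX (margY V) := by
  classical
  obtain ⟨h₀, h₁, c, hc, hlaw⟩ := h
  have hP := hPX.1
  have henc := fun n => (c n).sum_enc_eq hrank h₁ hPX (hlaw n)
  refine ⟨?_, ?_⟩
  · by_contra hne
    have hpos : 0 < R₁ := lt_of_le_of_ne h₁ (Ne.symm hne)
    have := le_of_tendsto_of_tendsto' ((tendsto_inv_numMsg hpos).const_sub 1) hc fun n =>
      (c n).one_sub_inv_le_errorProb hV h₀ h₁ (iidDist_mem_stdSimplex hP n).2 (henc n)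
    norm_num at this
  · obtain ⟨k, f, g, hfg, hker⟩ := exists_common_part hP (isChannel_margY hV)
    obtain ⟨γ, hγ0, hγ1, hgap⟩ :=
      exists_spectralGap hP (isChannel_margY hV) (isChannel_detChannel f) hker
    refine le_trans ?_ (entropy_le_gkCommonInformation hP hfg)
    by_contra! hlt
    -- With `H(f(X)) < r < R₀` and threshold `τ = e^{-nr}`, both terms on the right of the agreement
    -- bound vanish while the left side tends to 1.
    obtain ⟨r, hr1, hr2⟩ := exists_between hlt
    have hlim1 := ((hc.const_mul 2).div_const γ).const_sub 1
    have hlim2 : Tendsto (fun n : ℕ => (numMsg n R₀ : ℝ)⁻¹ / Real.exp (n * -r)) atTop (𝓝 0) := by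
      refine squeeze_zero (fun n => by positivity) (fun n => ?_)
        (by simpa using (tendsto_exp_mul_atTop (sub_neg.2 hr2)).const_mul 2)
      rw [div_le_iff₀ (Real.exp_pos _)]
      refine (inv_numMsg_le n h₀).trans_eq ?_
      rw [mul_assoc, ← Real.exp_add]
      ring_nf
    have hlim3 := tendsto_sum_prod_lt_exp (pushforward_mem_stdSimplex hP f) (neg_lt_neg hr1)
    have := le_of_tendsto_of_tendsto' hlim1 (hlim2.add hlim3) fun n =>
      (c n).agreement_bound hV h₀ h₁ hP (henc n) hγ0 hγ1 hgap (Real.exp_pos _)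
    norm_num at this

end Code

/-! ### Achievability -/

section Achievability

variable {X Y Z : Type*} [Fintype X] [Fintype Y] [Fintype Z]

theorem numMsg_zero (n : ℕ) : numMsg n 0 = 1 := by simp [numMsg]

/-- A coupling of the message with the letters of a common part yields a code with error
probability equal to the probability that the letters do not determine the message. -/
theorem exists_secrecyCode_of_coupling {V : X → Y × Z → ℝ} (hV : IsChannel V) {P : X → ℝ}
    (hP : P ∈ stdSimplex ℝ X) {k : ℕ} {f : X → Fin k} {g : Y → Fin k}
    (hfg : ∀ x y, P x * margY V x y ≠ 0 → f x = g y) {n : ℕ} {R₀ : ℝ} (h₀ : 0 ≤ R₀)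
    {Q : Fin (numMsg n R₀) → (Fin n → Fin k) → ℝ} (φ : (Fin n → Fin k) → Fin (numMsg n R₀))
    (hQ0 : ∀ m w, 0 ≤ Q m w) (hQq : ∀ w, ∑ m, Q m w = iidDist n (pushforward P f) w)
    (hQL : ∀ m, ∑ w, Q m w = (numMsg n R₀ : ℝ)⁻¹) :
    ∃ c : SecrecyCode X Y n R₀ 0,
      c.errorProb V = ∑ w, (iidDist n (pushforward P f) w - Q (φ w) w) ∧
      ∀ m₁ x, (numMsg n R₀ : ℝ)⁻¹ * ∑ m₀, c.enc (m₀, m₁) x = iidDist n P x := by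
  classical
  set q := iidDist n (pushforward P f) with hq
  have hqmem := iidDist_mem_stdSimplex (pushforward_mem_stdSimplex hP f) n
  have hPn := iidDist_mem_stdSimplex hP n
  have hWn := isChannel_iidChannel (isChannel_margY hV) n
  have hL : (numMsg n R₀ : ℝ) ≠ 0 := by exact_mod_cast (numMsg_pos n h₀).ne'
  have hQz : ∀ m w, q w = 0 → Q m w = 0 := fun m w h => by
    rw [← hQq w] at h
    exact (Finset.sum_eq_zero_iff_of_nonneg fun m _ => hQ0 m w).1 h m (Finset.mem_univ m)
  have hQdiv : ∀ m w, Q m w / q w * q w = Q m w := fun m w => by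
    by_cases h : q w = 0
    · simp [h, hQz m w h]
    · exact div_mul_cancel₀ _ h
  have hPz : ∀ x : Fin n → X, q (f ∘ x) = 0 → iidDist n P x = 0 := fun x h => by
    refine le_antisymm ?_ (hPn.1 x)
    rw [← h]
    exact Finset.prod_le_prod (fun _ _ => hP.1 _) fun i _ => le_pushforward hP f (x i)
  let m₁ : Fin (numMsg n 0) := ⟨0, numMsg_pos n le_rfl⟩
  -- The encoder draws `w` from `Q m` normalized, then `x` from `Pⁿ` conditioned on `f ∘ x = w`. The
  -- decoder applies `φ` to `g ∘ y`, which almost surely equals `f ∘ x`.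
  let c : SecrecyCode X Y n R₀ 0 :=
    { enc := fun m x => numMsg n R₀ * (Q m.1 (f ∘ x) / q (f ∘ x)) * iidDist n P x
      enc_channel := fun m => ⟨fun x => mul_nonneg (mul_nonneg (Nat.cast_nonneg _)
          (div_nonneg (hQ0 _ _) (hqmem.1 _))) (hPn.1 x), by
        simp only [mul_assoc, ← Finset.mul_sum]
        rw [sum_comp_mul_iidDist P f n (fun w => Q m.1 w / q w)]
        simp only [← hq, hQdiv, hQL]
        exact mul_inv_cancel₀ hL⟩
      dec := fun y m => if m = (φ (g ∘ y), m₁) then 1 else 0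
      dec_channel := fun y => ⟨fun m => by
        change (0 : ℝ) ≤ if _ then _ else _
        split_ifs <;> norm_num, by simp⟩ }
  have hfgn : ∀ x y, iidDist n P x * iidChannel n (margY V) x y ≠ 0 → f ∘ x = g ∘ y := by
    intro x y h
    ext1 i
    refine hfg _ _ fun h0 => h ?_
    simp only [iidDist, iidChannel, ← Finset.prod_mul_distrib]
    exact Finset.prod_eq_zero (Finset.mem_univ i) h0
  refine ⟨c, ?_, fun m x => ?_⟩
  · rw [c.errorProb_eq hV h₀ le_rfl, Finset.sum_sub_distrib, hqmem.2, Finset.sum_comm]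
    congr 1
    have hx : ∀ x, ∑ m, ∑ y, ((numMsg n R₀ : ℝ)⁻¹ * (numMsg n 0 : ℝ)⁻¹) * c.enc m x *
        iidChannel n (margY V) x y * c.dec y m =
        Q (φ (f ∘ x)) (f ∘ x) / q (f ∘ x) * iidDist n P x := by
      intro x
      rw [Finset.sum_comm]
      calc _ = ∑ y, Q (φ (f ∘ x)) (f ∘ x) / q (f ∘ x) *
            (iidDist n P x * iidChannel n (margY V) x y) := by
            refine Finset.sum_congr rfl fun y _ => ?_
            have : ∀ m, ((numMsg n R₀ : ℝ)⁻¹ * (numMsg n 0 : ℝ)⁻¹) * c.enc m x *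
                iidChannel n (margY V) x y * c.dec y m = if m = (φ (g ∘ y), m₁) then
                  Q m.1 (f ∘ x) / q (f ∘ x) * (iidDist n P x * iidChannel n (margY V) x y)
                else 0 := by
              intro m
              simp only [c, numMsg_zero, Nat.cast_one, inv_one, mul_one]
              split_ifs
              · field_simp
              · simp
            simp only [this, Finset.sum_ite_eq', Finset.mem_univ, if_true]
            by_cases h : iidDist n P x * iidChannel n (margY V) x y = 0
            · simp [h]
            · rw [hfgn x y h]
        _ = _ := by simp only [← Finset.mul_sum, (hWn x).2, mul_one]
    simp only [hx]
    rw [sum_comp_mul_iidDist P f n (fun w => Q (φ w) w / q w)]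
    exact Finset.sum_congr rfl fun w _ => hQdiv _ _
  · change (numMsg n R₀ : ℝ)⁻¹ *
      ∑ m₀, numMsg n R₀ * (Q m₀ (f ∘ x) / q (f ∘ x)) * iidDist n P x = _
    rw [← Finset.sum_mul, ← Finset.mul_sum, ← Finset.sum_div, hQq, ← mul_assoc, ← mul_assoc,
      inv_mul_cancel₀ hL, one_mul]
    by_cases h : q (f ∘ x) = 0
    · rw [hPz x h, mul_zero]
    · rw [div_self h, one_mul]

theorem achievable_of_sum_enc_eq {V : X → Y × Z → ℝ} {PZ : Z → ℝ} {PX : X → ℝ}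
    (hPX : PX ∈ inputs (margZ V) PZ) {R₀ : ℝ} (h₀ : 0 ≤ R₀) (c : (n : ℕ) → SecrecyCode X Y n R₀ 0)
    (hc : Tendsto (fun n => (c n).errorProb V) atTop (𝓝 0))
    (henc : ∀ n m₁ x, (numMsg n R₀ : ℝ)⁻¹ * ∑ m₀, (c n).enc (m₀, m₁) x = iidDist n PX x) :
    Achievable V PZ R₀ 0 := by
  refine ⟨h₀, le_rfl, c, hc, fun n m₁ z => ?_⟩
  have hPZ : PZ = outDist PX (margZ V) := by
    ext z
    rw [← hPX.2 z]
    exact Finset.sum_congr rfl fun x _ => mul_comm _ _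
  rw [(c n).lawM₁Z_eq]
  simp only [henc]
  congr 1
  rw [hPZ]
  exact congrFun (outDist_iid PX (margZ V) n) z

theorem achievable_zero {V : X → Y × Z → ℝ} (hV : IsChannel V) {PZ : Z → ℝ} {PX : X → ℝ}
    (hPX : PX ∈ inputs (margZ V) PZ) : Achievable V PZ 0 0 := by
  have h : ∀ n, ∃ c : SecrecyCode X Y n 0 0, c.errorProb V = 0 ∧
      ∀ m₁ x, (numMsg n 0 : ℝ)⁻¹ * ∑ m₀, c.enc (m₀, m₁) x = iidDist n PX x := by
    intro n
    have hq := iidDist_mem_stdSimplex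
      (pushforward_mem_stdSimplex (k := 1) hPX.1 (fun _ => 0)) n
    obtain ⟨c, hc, henc⟩ := exists_secrecyCode_of_coupling hV hPX.1 (k := 1) (f := fun _ => 0)
      (g := fun _ => 0) (fun _ _ _ => rfl) (n := n) le_rfl
      (Q := fun _ => iidDist n (pushforward PX fun _ => 0)) (fun _ => ⟨0, numMsg_pos n le_rfl⟩)
      (fun _ => hq.1) (fun w => by simp [numMsg_zero]) fun m => by
        rw [hq.2, numMsg_zero, Nat.cast_one, inv_one]
    exact ⟨c, by simpa using hc, henc⟩
  choose c hc henc using h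
  exact achievable_of_sum_enc_eq hPX le_rfl c (by simp [hc]) henc

theorem achievable_of_lt {V : X → Y × Z → ℝ} (hV : IsChannel V) {PZ : Z → ℝ} {PX : X → ℝ}
    (hPX : PX ∈ inputs (margZ V) PZ) {R₀ : ℝ} (h₀ : 0 ≤ R₀)
    (hR : R₀ < gkCommonInformation PX (margY V)) : Achievable V PZ R₀ 0 := by
  obtain ⟨k, f, g, hfg, hlt⟩ := exists_entropy_gt hR
  -- With `R₀ < r < H(f(X))` and `τ = e^{-nr}`, both `L * τ` and the probability of letters heavier
  -- than `τ` vanish.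
  obtain ⟨r, hr1, hr2⟩ := exists_between hlt
  have hp := pushforward_mem_stdSimplex hPX.1 f
  have h : ∀ n, ∃ c : SecrecyCode X Y n R₀ 0,
      c.errorProb V ≤ numMsg n R₀ * Real.exp (n * -r) +
        (∑ w, if Real.exp (n * -r) < iidDist n (pushforward PX f) w then
          iidDist n (pushforward PX f) w else 0) ∧
      ∀ m₁ x, (numMsg n R₀ : ℝ)⁻¹ * ∑ m₀, c.enc (m₀, m₁) x = iidDist n PX x := by
    intro n
    obtain ⟨Q, φ, hQ0, hQq, hQL, hφ⟩ := exists_coupling (iidDist_mem_stdSimplex hp n)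
      (numMsg_pos n h₀) (Real.exp_nonneg (n * -r))
    obtain ⟨c, hc, henc⟩ :=
      exists_secrecyCode_of_coupling hV hPX.1 hfg h₀ φ hQ0 hQq hQL
    exact ⟨c, hc.trans_le hφ, henc⟩
  choose c hc henc using h
  refine achievable_of_sum_enc_eq hPX h₀ c ?_ henc
  have hlim1 : Tendsto (fun n : ℕ => (numMsg n R₀ : ℝ) * Real.exp (n * -r)) atTop (𝓝 0) := by
    refine squeeze_zero (fun n => by positivity) (fun n => ?_)
      (tendsto_exp_mul_atTop (sub_neg.2 hr1))
    refine (mul_le_mul_of_nonneg_right (numMsg_le n R₀) (Real.exp_nonneg _)).trans_eq ?_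
    rw [← Real.exp_add]
    ring_nf
  have hlim2 := tendsto_sum_exp_lt_prod hp (neg_lt_neg hr2)
  have hlim := hlim1.add hlim2
  rw [add_zero] at hlim
  refine squeeze_zero (fun n => ?_) hc hlim
  refine Finset.sum_nonneg fun m _ => Finset.sum_nonneg fun x _ => Finset.sum_nonneg fun y _ =>
    Finset.sum_nonneg fun z _ => Finset.sum_nonneg fun m' _ => ?_
  split_ifs
  · exact mul_nonneg (mul_nonneg (mul_nonneg (by positivity) (((c n).enc_channel m).1 x))
      (Finset.prod_nonneg fun i _ => (hV _).1 _)) (((c n).dec_channel y).1 m')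
  · exact le_rfl

end Achievability

/-! ### The region and the capacities -/

theorem region_eq {X Y Z : Type*} [Fintype X] [Fintype Y] [Fintype Z] {V : X → Y × Z → ℝ}
    (hV : IsChannel V) (hrank : IsFullRank (margZ V)) {PZ : Z → ℝ} {PX : X → ℝ}
    (hPX : PX ∈ inputs (margZ V) PZ) :
    region V PZ = {p : ℝ × ℝ | 0 ≤ p.1 ∧ p.1 ≤ gkCommonInformation PX (margY V) ∧ p.2 = 0} := by
  refine Set.Subset.antisymm (closure_minimal (fun p hp => ?_) ?_) ?_
  · obtain ⟨h1, h2⟩ := hp.eq_zero_and_le hV hrank hPX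
    exact ⟨hp.1, h2, h1⟩
  · exact (isClosed_le continuous_const continuous_fst).inter
      ((isClosed_le continuous_fst continuous_const).inter
        (isClosed_eq continuous_snd continuous_const))
  · rintro ⟨r, s⟩ ⟨h0, h1, h2⟩
    simp only at h0 h1 h2
    subst h2
    -- Rates strictly below the common information are dense in the interval unless it is the point
    -- 0, which needs the code with a single message.
    rcases eq_or_lt_of_le (gkCommonInformation_nonneg hPX.1 (margY V)) with hgk | hgk
    · obtain rfl : r = 0 := le_antisymm (hgk ▸ h1) h0
      exact subset_closure (achievable_zero hV hPX)
    · have hr : r ∈ closure (Set.Ico 0 (gkCommonInformation PX (margY V))) := by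
        rw [closure_Ico hgk.ne]
        exact ⟨h0, h1⟩
      have hcont : Continuous fun r : ℝ => (r, (0 : ℝ)) := by fun_prop
      refine closure_mono ?_ (image_closure_subset_closure_image hcont ⟨r, hr, rfl⟩)
      rintro _ ⟨r, hr, rfl⟩
      exact achievable_of_lt hV hPX hr.1 hr.2

end Wiretap

theorem mainTheorem11 {X Y Z : Type*} [Fintype X] [Fintype Y] [Fintype Z]
    {G : Type*} [AddCommGroup G] [IsAddTorsionFree G]
    (V : X → Y × Z → ℝ) (hV : Wiretap.IsChannel V) :
    (Wiretap.IsFullRank (Wiretap.margZ V) →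
      ∀ PZ : Z → ℝ, (Wiretap.inputs (Wiretap.margZ V) PZ).Nonempty →
      ∃ PX : X → ℝ, Wiretap.inputs (Wiretap.margZ V) PZ = {PX} ∧
        Wiretap.region V PZ =
          {p : ℝ × ℝ | 0 ≤ p.1 ∧ p.1 ≤ Wiretap.gkCommonInformation PX (Wiretap.margY V) ∧
            p.2 = 0} ∧
        IsGreatest (Prod.fst '' Wiretap.region V PZ) (Wiretap.stealthCapacity V PZ) ∧
        Wiretap.stealthCapacity V PZ = Wiretap.gkCommonInformation PX (Wiretap.margY V) ∧
        IsGreatest (Prod.snd '' Wiretap.region V PZ) (Wiretap.stealthSecrecyCapacity V PZ) ∧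
        Wiretap.stealthSecrecyCapacity V PZ = 0) ∧
    (Wiretap.IsIdentityChannel (Wiretap.margZ V) → Wiretap.IsFullRank (Wiretap.margZ V)) ∧
    (Wiretap.IsAdditiveChannel G (Wiretap.margZ V) → Wiretap.IsFullRank (Wiretap.margZ V)) := by
  refine ⟨fun hrank PZ ⟨PX, hPX⟩ => ?_, fun h => h.isFullRank,
    fun h => h.isFullRank (Wiretap.isChannel_margZ hV)⟩
  have hregion := Wiretap.region_eq hV hrank hPX
  have hnn := Wiretap.gkCommonInformation_nonneg hPX.1 (Wiretap.margY V)
  have h0 : IsGreatest (Prod.fst '' Wiretap.region V PZ)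
      (Wiretap.gkCommonInformation PX (Wiretap.margY V)) := by
    rw [hregion]
    refine ⟨⟨(_, 0), ⟨hnn, le_rfl, rfl⟩, rfl⟩, ?_⟩
    rintro _ ⟨p, hp, rfl⟩
    exact hp.2.1
  have h1 : IsGreatest (Prod.snd '' Wiretap.region V PZ) 0 := by
    rw [hregion]
    refine ⟨⟨(0, 0), ⟨le_rfl, hnn, rfl⟩, rfl⟩, ?_⟩
    rintro _ ⟨p, hp, rfl⟩
    exact hp.2.2.le
  have e0 : Wiretap.stealthCapacity V PZ = Wiretap.gkCommonInformation PX (Wiretap.margY V) :=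
    h0.csSup_eq
  have e1 : Wiretap.stealthSecrecyCapacity V PZ = 0 := h1.csSup_eq
  exact ⟨PX, hrank.inputs_eq_singleton hPX, hregion, e0 ▸ h0, e0, e1 ▸ h1, e1⟩
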